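/- Let $(F_n)_{n \geq 1}$ be the Fibonacci numbers, $F_1 = F_2 = 1$ and $F_{n+2} = F_{n+1} + F_n$ for all $n \geq 1$, and let $(s_n)_{n \geq 1}$ be a sequence of independent random variables, each uniformly distributed in $\{-1, +1\}$. Then $$\mathbb{E}\big[\log \operatorname{lcm}(F_3 + s_3, F_4 + s_4, \dots, F_n + s_n)\big] \sim \frac{3 \log \alpha}{\pi^2} \cdot \frac{15\, \mathrm{Li}_2(1/16)}{2} \cdot n^2 \qquad \text{as } n \to +\infty,$$ where $\alpha := (1 + \sqrt{5})/2$ is the golden ratio and $\mathrm{Li}_2(z) := \sum_{n=1}^{\infty} z^n / n^2$ is the dilogarithm. -/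

import Mathlib

/-- The dilogarithm `Li₂(z) = ∑_{n ≥ 1} zⁿ / n²` (the series converges for `|z| ≤ 1`),
with the summation index shifted so that it starts at `0`. -/
noncomputable def dilog (z : ℝ) : ℝ := ∑' n : ℕ, z ^ (n + 1) / ((n : ℝ) + 1) ^ 2

/-- `lcm(F₃ + s₃, F₄ + s₄, …, Fₙ + sₙ)`, the nonnegative least common multiple in `ℤ`
(equal to `1` when `n < 3`). -/
def shiftedFibLcm (s : ℕ → ℤ) (n : ℕ) : ℤ :=
  (Finset.Icc 3 n).lcm fun k => (Nat.fib k : ℤ) + s k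

/-- `(s_n)_{n ≥ 1}` is a sequence of independent random variables, each uniformly distributed
in `{-1, +1}`. Nothing is required of the unused index `0`. -/
structure IsRandomSigns {Ω : Type*} [MeasurableSpace Ω] (P : MeasureTheory.Measure Ω)
    (s : ℕ → Ω → ℤ) : Prop where
  measurable : ∀ n, 1 ≤ n → Measurable (s n)
  prob_pos : ∀ n, 1 ≤ n → P {ω | s n ω = 1} = 1 / 2
  prob_neg : ∀ n, 1 ≤ n → P {ω | s n ω = -1} = 1 / 2
  indep : ProbabilityTheory.iIndepFun (fun n : ℕ+ => s n) P

/-!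
# The expected logarithm of the lcm of randomly shifted Fibonacci numbers

Write `Fₙ = ∏_{d ∣ n} C_d` with `C_d` the primitive parts of the Fibonacci numbers. Strong
divisibility, `gcd (F_a, F_b) = F_{gcd (a, b)}`, makes the `C_d` natural numbers
(`lcm_fib_eq_prod_fibPrimitivePart`) and makes them nearly coprime: `C_d` and `C_e` are coprime
unless one index divides the other, and if `d ∣ e` then their gcd divides `e / d`. Möbius inversion
gives `log C_d = φ(d) log α + O(τ(d))` (`abs_log_fibPrimitivePart_sub_le`).

Each `F_k ± 1` factors as `F_a L_b` with `{a, b} = {⌊(k - 1) / 2⌋, ⌊k / 2⌋ + 1}`, the sign deciding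
which index is `a` (`fib_add_sign_eq`), and `L_b = F_{2b} / F_b` is again a product of primitive
parts. Hence `log lcm (F₃ + s₃, …, F_n + s_n)` is the sum of `φ(d) log α` over the set of indices
`d` of primitive parts that occur, up to `O(n log² n)` (`log_shiftedFibLcm_le` and
`le_log_shiftedFibLcm`, the latter by `prod_fibPrimitivePart_le`).

Let `e = d` for odd `d` and `e = d / 2` for even `d`. If `e ≥ 3`, then `C_d` can occur in
`F_k + s_k` only if `k = 2m ± 1` or `k = 2m ± 2` for a multiple `m` of `e`, and then it does so for
exactly one of the two signs. Independence therefore gives that `C_d` occurs with probability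
`1 - 2^{-r}`, where `r` is `4 ⌊n / 2e⌋` up to a shift of `n` by at most `2`
(`IsRandomSigns.one_sub_le_measureReal`). Since the totients of the `d` that share a given `e` add
up to `2 φ(e)`, the expectation is asymptotic to
`log α ∑_e 2 φ(e) (1 - 16^{-⌊n / 2e⌋}) = log α ∑_{j ≥ 1} 30 · 16^{-j} ∑_{e ≤ n / 2j} φ(e)`.
From `∑_{e ≤ x} φ(e) ∼ 3 x² / π²` and dominated convergence (`tendsto_sum_totient_weighted`), the
constant `(3 log α / π²) (15 / 2) ∑_{j ≥ 1} 16^{-j} / j²` follows.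
-/

open Finset

/-! ### Primitive parts of Fibonacci numbers -/

/-- The primitive part `Cₙ` of the Fibonacci number `Fₙ`: what is left of `Fₙ` after dividing by
the least common multiple of the `F_d` over the proper divisors `d` of `n`. -/
def fibPrimitivePart (n : ℕ) : ℕ := Nat.fib n / n.properDivisors.lcm Nat.fib

theorem fibPrimitivePart_mul_lcm (n : ℕ) :
    fibPrimitivePart n * n.properDivisors.lcm Nat.fib = Nat.fib n :=
  Nat.div_mul_cancel <| Finset.lcm_dvd fun d hd =>
    Nat.fib_dvd d n (Nat.mem_properDivisors.1 hd).1

theorem fibPrimitivePart_pos {n : ℕ} (hn : 0 < n) : 0 < fibPrimitivePart n := by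
  rcases Nat.eq_zero_or_pos (fibPrimitivePart n) with h | h
  · have := fibPrimitivePart_mul_lcm n
    rw [h, zero_mul] at this
    exact absurd this.symm (Nat.fib_pos.2 hn).ne'
  · exact h

theorem Nat.gcd_lcm_left_distrib (a b x : ℕ) :
    Nat.gcd (Nat.lcm a b) x = Nat.lcm (Nat.gcd a x) (Nat.gcd b x) := by
  rcases eq_or_ne x 0 with rfl | hx
  · simp
  rcases eq_or_ne a 0 with rfl | ha
  · simpa using (Nat.lcm_eq_left (Nat.gcd_dvd_right b x)).symm
  rcases eq_or_ne b 0 with rfl | hb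
  · simpa using (Nat.lcm_eq_right (Nat.gcd_dvd_right a x)).symm
  have hax := Nat.gcd_ne_zero_right (m := a) hx
  have hbx := Nat.gcd_ne_zero_right (m := b) hx
  have hab := Nat.lcm_ne_zero ha hb
  refine Nat.eq_of_factorization_eq (Nat.gcd_ne_zero_right hx) (Nat.lcm_ne_zero hax hbx)
    fun p => ?_
  rw [Nat.factorization_gcd hab hx, Nat.factorization_lcm ha hb, Nat.factorization_lcm hax hbx,
    Nat.factorization_gcd ha hx, Nat.factorization_gcd hb hx]
  exact inf_sup_right _ _ _

theorem Nat.gcd_finset_lcm {ι : Type*} [DecidableEq ι] (S : Finset ι) (f : ι → ℕ) (x : ℕ) :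
    Nat.gcd (S.lcm f) x = S.lcm fun i => Nat.gcd (f i) x := by
  induction S using Finset.induction_on with
  | empty => simp
  | insert a S _ ih =>
    rw [Finset.lcm_insert, Finset.lcm_insert, ← ih]
    simp only [lcm_eq_nat_lcm]
    exact Nat.gcd_lcm_left_distrib _ _ _

/-- The lcm of the Fibonacci numbers over a finite divisor-closed index set is the product of
the primitive parts. The induction removes the largest index `n`: by strong divisibility,
`gcd (F_k, Fₙ) = F_{gcd (k, n)}`, so what `Fₙ` adds to the lcm is exactly its primitive part. -/
theorem lcm_fib_eq_prod_fibPrimitivePart (S : Finset ℕ) (hpos : ∀ n ∈ S, 0 < n)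
    (hS : ∀ n ∈ S, ∀ d, d ∣ n → d ∈ S) :
    S.lcm Nat.fib = ∏ d ∈ S, fibPrimitivePart d := by
  induction S using Finset.induction_on_max with
  | empty => simp
  | insert n S hmax ih =>
    have hnS : n ∉ S := fun h => lt_irrefl _ (hmax n h)
    have hn : 0 < n := hpos n (mem_insert_self _ _)
    have hS' : ∀ m ∈ S, ∀ d, d ∣ m → d ∈ S := by
      intro m hm d hd
      rcases mem_insert.1 (hS m (mem_insert_of_mem hm) d hd) with h | h
      · have := Nat.le_of_dvd (hpos m (mem_insert_of_mem hm)) hd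
        have := hmax m hm
        omega
      · exact h
    have ih' := ih (fun m hm => hpos m (mem_insert_of_mem hm)) hS'
    have hgcd : Nat.gcd (S.lcm Nat.fib) (Nat.fib n) = n.properDivisors.lcm Nat.fib := by
      rw [Nat.gcd_finset_lcm]
      apply Nat.dvd_antisymm
      · refine Finset.lcm_dvd fun k hk => ?_
        rw [← Nat.fib_gcd]
        refine Finset.dvd_lcm (Nat.mem_properDivisors.2 ⟨Nat.gcd_dvd_right _ _, ?_⟩)
        exact (Nat.le_of_dvd (hpos k (mem_insert_of_mem hk)) (Nat.gcd_dvd_left _ _)).trans_lt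
          (hmax k hk)
      · refine Finset.lcm_dvd fun d hd => ?_
        obtain ⟨hdn, hlt⟩ := Nat.mem_properDivisors.1 hd
        have hdS : d ∈ S := by
          rcases mem_insert.1 (hS n (mem_insert_self _ _) d hdn) with h | h
          · omega
          · exact h
        have := Finset.dvd_lcm (f := fun i => Nat.gcd (Nat.fib i) (Nat.fib n)) hdS
        rwa [← Nat.fib_gcd, Nat.gcd_eq_left hdn] at this
    rw [Finset.lcm_insert, Finset.prod_insert hnS, ← ih', lcm_eq_nat_lcm]
    have h1 := Nat.gcd_mul_lcm (S.lcm Nat.fib) (Nat.fib n)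
    have h2 := fibPrimitivePart_mul_lcm n
    rw [hgcd, ← h2] at h1
    have hL : 0 < n.properDivisors.lcm Nat.fib := by
      rcases Nat.eq_zero_or_pos (n.properDivisors.lcm Nat.fib) with h | h
      · rw [h, mul_zero] at h2
        exact absurd h2.symm (Nat.fib_pos.2 hn).ne'
      · exact h
    rw [h2] at h1
    apply Nat.eq_of_mul_eq_mul_left hL
    rw [Nat.lcm_comm, h1, ← h2]
    ring

theorem prod_divisors_fibPrimitivePart {n : ℕ} (hn : 0 < n) :
    ∏ d ∈ n.divisors, fibPrimitivePart d = Nat.fib n := by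
  rw [← lcm_fib_eq_prod_fibPrimitivePart _ (fun m hm => Nat.pos_of_mem_divisors hm)
    (fun m hm d hd => Nat.mem_divisors.2 ⟨hd.trans (Nat.dvd_of_mem_divisors hm), hn.ne'⟩)]
  exact Nat.dvd_antisymm
    (Finset.lcm_dvd fun d hd => Nat.fib_dvd d n (Nat.dvd_of_mem_divisors hd))
    (Finset.dvd_lcm (Nat.mem_divisors_self n hn.ne'))

theorem fibPrimitivePart_dvd_fib (n : ℕ) : fibPrimitivePart n ∣ Nat.fib n :=
  ⟨_, (fibPrimitivePart_mul_lcm n).symm⟩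

theorem fibPrimitivePart_dvd_fib_div {d e : ℕ} (he : 0 < e) (hd : d ∣ e) (hlt : d < e) :
    fibPrimitivePart e ∣ Nat.fib e / Nat.fib d := by
  have hF : Nat.fib d ∣ e.properDivisors.lcm Nat.fib :=
    Finset.dvd_lcm (Nat.mem_properDivisors.2 ⟨hd, hlt⟩)
  obtain ⟨c, hc⟩ := hF
  have hd0 : 0 < Nat.fib d := Nat.fib_pos.2 (Nat.pos_of_dvd_of_pos hd he)
  refine ⟨c, Nat.div_eq_of_eq_mul_left hd0 ?_⟩
  rw [← fibPrimitivePart_mul_lcm e, hc]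
  ring

/-! ### Near coprimality of the primitive parts -/

/-- The congruence `F_{mk} / F_m ≡ k F_{m+1}^{k-1} (mod F_m)`, stated for `k + 1` in place of `k`
and together with the congruence for `F_{mk+1}` that its induction needs. -/
theorem fib_mul_modEq (m k : ℕ) : ∃ q : ℕ, Nat.fib (m * (k + 1)) = Nat.fib m * q ∧
    q ≡ (k + 1) * Nat.fib (m + 1) ^ k [MOD Nat.fib m] ∧
    Nat.fib (m * (k + 1) + 1) ≡ Nat.fib (m + 1) ^ (k + 1) [MOD Nat.fib m] := by
  rcases m with _ | b
  · exact ⟨k + 1, by simp, by simp, by simp⟩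
  have hb : Nat.fib b ≡ Nat.fib (b + 1 + 1) [MOD Nat.fib (b + 1)] := by
    rw [Nat.fib_add_two]
    simp [Nat.ModEq]
  induction k with
  | zero => exact ⟨1, by simp, by simp [Nat.ModEq], by simp [Nat.ModEq]⟩
  | succ k ih =>
    obtain ⟨q, hq, h1, h2⟩ := ih
    refine ⟨q * Nat.fib b + Nat.fib ((b + 1) * (k + 1) + 1), ?_, ?_, ?_⟩
    · rw [show (b + 1) * (k + 1 + 1) = (b + 1) * (k + 1) + b + 1 by ring, Nat.fib_add, hq]
      ring
    · have := (h1.mul hb).add h2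
      refine this.trans (congrArg (· % Nat.fib (b + 1)) ?_)
      ring
    · rw [show (b + 1) * (k + 1 + 1) + 1 = (b + 1) * (k + 1) + (b + 1) + 1 by ring, Nat.fib_add,
        hq]
      have h3 : Nat.fib (b + 1) * q * Nat.fib (b + 1) ≡ 0 [MOD Nat.fib (b + 1)] :=
        (Nat.modEq_zero_iff_dvd).2 (Dvd.intro_left _ rfl)
      refine (h3.add (h2.mul_right (Nat.fib (b + 1 + 1)))).trans (congrArg (· % Nat.fib (b + 1)) ?_)
      ring

/-- For `d ∣ e` with `d < e`, the number `C_e` divides `F_e / F_d`, which modulo `F_d` is `e / d`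
times a unit. -/
theorem gcd_fibPrimitivePart_dvd {d e : ℕ} (he : 0 < e) (hd : d ∣ e) (hlt : d < e) :
    Nat.gcd (fibPrimitivePart d) (fibPrimitivePart e) ∣ e / d := by
  have hd0 : 0 < d := Nat.pos_of_dvd_of_pos hd he
  have hF0 : 0 < Nat.fib d := Nat.fib_pos.2 hd0
  obtain ⟨k, rfl⟩ := hd
  obtain ⟨k, rfl⟩ : ∃ j, k = j + 1 := ⟨k - 1, by
    rcases k with _ | k
    · simp at he
    · rfl⟩
  obtain ⟨q, hq, hmod, -⟩ := fib_mul_modEq d k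
  rw [Nat.mul_div_cancel_left _ hd0]
  set g := Nat.gcd (fibPrimitivePart d) (fibPrimitivePart (d * (k + 1)))
  have hgF : g ∣ Nat.fib d := (Nat.gcd_dvd_left _ _).trans (fibPrimitivePart_dvd_fib d)
  have hgq : g ∣ q := by
    have := (Nat.gcd_dvd_right (fibPrimitivePart d) (fibPrimitivePart (d * (k + 1)))).trans
      (fibPrimitivePart_dvd_fib_div he (Dvd.intro _ rfl) hlt)
    rwa [hq, Nat.mul_div_cancel_left _ hF0] at this
  have h2 : g ∣ (k + 1) * Nat.fib (d + 1) ^ k :=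
    ((hmod.of_dvd hgF).dvd_iff dvd_rfl).1 hgq
  have hcop : Nat.Coprime g (Nat.fib (d + 1) ^ k) :=
    ((Nat.fib_coprime_fib_succ d).coprime_dvd_left hgF).pow_right k
  exact hcop.dvd_of_dvd_mul_right h2

/-- With `g = gcd (d, e)`, the numbers `F_d / F_g` and `F_e / F_g` are coprime, because
`F_g = gcd (F_d, F_e)`. -/
theorem coprime_fibPrimitivePart {d e : ℕ} (hd0 : 0 < d) (he0 : 0 < e) (hde : ¬ d ∣ e)
    (hed : ¬ e ∣ d) : Nat.Coprime (fibPrimitivePart d) (fibPrimitivePart e) := by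
  have hg0 : 0 < Nat.gcd d e := Nat.gcd_pos_of_pos_left _ hd0
  have hgd : Nat.gcd d e < d := lt_of_le_of_ne (Nat.gcd_le_left _ hd0) fun h =>
    hde (h ▸ Nat.gcd_dvd_right d e)
  have hge : Nat.gcd d e < e := lt_of_le_of_ne (Nat.gcd_le_right _ he0) fun h =>
    hed (h ▸ Nat.gcd_dvd_left d e)
  have h1 := fibPrimitivePart_dvd_fib_div hd0 (Nat.gcd_dvd_left d e) hgd
  have h2 := fibPrimitivePart_dvd_fib_div he0 (Nat.gcd_dvd_right d e) hge
  have h3 : Nat.Coprime (Nat.fib d / Nat.fib (Nat.gcd d e))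
      (Nat.fib e / Nat.fib (Nat.gcd d e)) := by
    rw [Nat.fib_gcd]
    exact Nat.coprime_div_gcd_div_gcd (Nat.gcd_pos_of_pos_left _ (Nat.fib_pos.2 hd0))
  exact Nat.Coprime.coprime_dvd_left h1 (Nat.Coprime.coprime_dvd_right h2 h3)

theorem Nat.gcd_finset_prod_dvd {ι : Type*} [DecidableEq ι] (S : Finset ι) (f : ι → ℕ) (x : ℕ) :
    Nat.gcd (∏ i ∈ S, f i) x ∣ ∏ i ∈ S, Nat.gcd (f i) x := by
  induction S using Finset.induction_on with
  | empty => simp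
  | insert a S ha ih =>
    rw [Finset.prod_insert ha, Finset.prod_insert ha]
    refine dvd_trans ?_ (mul_dvd_mul_left _ ih)
    rw [Nat.gcd_comm, Nat.gcd_comm (f a), Nat.gcd_comm (∏ i ∈ S, f i)]
    exact Nat.gcd_mul_right_dvd_mul_gcd _ _ _

/-- The primitive parts are so nearly coprime that their lcm over any finite set of indices
loses at most a factor `∏ e ^ τ(e)` against their product. -/
theorem prod_fibPrimitivePart_le (D : Finset ℕ) (hpos : ∀ d ∈ D, 0 < d) :
    ∏ d ∈ D, fibPrimitivePart d ≤
      D.lcm fibPrimitivePart * ∏ e ∈ D, e ^ e.divisors.card := by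
  induction D using Finset.induction_on_max with
  | empty => simp
  | insert e D hmax ih =>
    have heD : e ∉ D := fun h => lt_irrefl _ (hmax e h)
    have he : 0 < e := hpos e (mem_insert_self _ _)
    have hpos' : ∀ d ∈ D, 0 < d := fun d hd => hpos d (mem_insert_of_mem hd)
    have hgcd : Nat.gcd (D.lcm fibPrimitivePart) (fibPrimitivePart e) ≤ e ^ e.divisors.card := by
      have h1 : Nat.gcd (D.lcm fibPrimitivePart) (fibPrimitivePart e) ∣
          ∏ d ∈ D, Nat.gcd (fibPrimitivePart d) (fibPrimitivePart e) :=
        (Nat.gcd_dvd_gcd_of_dvd_left _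
          (Finset.lcm_dvd fun d hd => Finset.dvd_prod_of_mem _ hd)).trans
          (Nat.gcd_finset_prod_dvd _ _ _)
      have h2 : ∏ d ∈ D, Nat.gcd (fibPrimitivePart d) (fibPrimitivePart e) ≤
          ∏ d ∈ D, (if d ∣ e then e else 1) := by
        refine Finset.prod_le_prod' fun d hd => ?_
        split_ifs with h
        · refine (Nat.le_of_dvd ?_ (gcd_fibPrimitivePart_dvd he h (hmax d hd))).trans
            (Nat.div_le_self _ _)
          exact Nat.div_pos (Nat.le_of_dvd he h) (hpos' d hd)
        · refine (Nat.coprime_iff_gcd_eq_one.1 (coprime_fibPrimitivePart (hpos' d hd) he h ?_)).le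
          intro h'
          exact absurd (Nat.le_of_dvd (hpos' d hd) h') (not_le.2 (hmax d hd))
      refine (Nat.le_of_dvd ?_ h1).trans (h2.trans ?_)
      · exact Finset.prod_pos fun d hd =>
          Nat.gcd_pos_of_pos_left _ (fibPrimitivePart_pos (hpos' d hd))
      · rw [Finset.prod_ite, Finset.prod_const, Finset.prod_const_one, mul_one]
        refine Nat.pow_le_pow_right he (Finset.card_le_card fun d hd => ?_)
        exact Nat.mem_divisors.2 ⟨(mem_filter.1 hd).2, he.ne'⟩
    rw [Finset.prod_insert heD, Finset.prod_insert heD, Finset.lcm_insert, lcm_eq_nat_lcm]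
    have h3 := Nat.gcd_mul_lcm (D.lcm fibPrimitivePart) (fibPrimitivePart e)
    calc fibPrimitivePart e * ∏ d ∈ D, fibPrimitivePart d
        ≤ fibPrimitivePart e * (D.lcm fibPrimitivePart * ∏ e ∈ D, e ^ e.divisors.card) :=
          Nat.mul_le_mul_left _ (ih hpos')
      _ = (D.lcm fibPrimitivePart).gcd (fibPrimitivePart e) *
          (D.lcm fibPrimitivePart).lcm (fibPrimitivePart e) *
            ∏ e ∈ D, e ^ e.divisors.card := by rw [h3]; ring
      _ ≤ e ^ e.divisors.card * (D.lcm fibPrimitivePart).lcm (fibPrimitivePart e) *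
            ∏ e ∈ D, e ^ e.divisors.card := by gcongr
      _ = _ := by rw [Nat.lcm_comm]; ring

/-! ### The size of the primitive parts -/

open Real in
theorem goldenRatio_pow_le_fib (n : ℕ) : goldenRatio ^ n ≤ Nat.fib (n + 2) ∧
    goldenRatio ^ (n + 1) ≤ Nat.fib (n + 3) := by
  induction n with
  | zero =>
    have := goldenRatio_lt_two
    norm_num [Nat.fib_add_two]
    exact this.le
  | succ n ih =>
    refine ⟨ih.2, ?_⟩
    rw [show n + 1 + 3 = n + 2 + 2 by ring, Nat.fib_add_two]
    push_cast
    have : goldenRatio ^ (n + 1 + 1) = goldenRatio ^ n * goldenRatio ^ 2 := by ring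
    rw [this, goldenRatio_sq]
    have := ih.1; have := ih.2
    rw [pow_succ] at this
    rw [show n + 2 + 1 = n + 3 by ring]
    linarith

open Real in
theorem fib_le_goldenRatio_pow (n : ℕ) : (Nat.fib n : ℝ) ≤ goldenRatio ^ n ∧
    (Nat.fib (n + 1) : ℝ) ≤ goldenRatio ^ (n + 1) := by
  induction n with
  | zero => simpa using one_lt_goldenRatio.le
  | succ n ih =>
    refine ⟨ih.2, ?_⟩
    rw [Nat.fib_add_two]
    push_cast
    have : goldenRatio ^ (n + 1 + 1) = goldenRatio ^ n * goldenRatio ^ 2 := by ring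
    rw [this, goldenRatio_sq]
    have := ih.1; have := ih.2
    rw [pow_succ] at this
    linarith

theorem abs_log_fib_sub_le {n : ℕ} (hn : 0 < n) :
    |Real.log (Nat.fib n) - n * Real.log Real.goldenRatio| ≤ 2 * Real.log Real.goldenRatio := by
  have hg := Real.goldenRatio_pos
  have hF : (0 : ℝ) < Nat.fib n := by exact_mod_cast Nat.fib_pos.2 hn
  have hlog : 0 ≤ Real.log Real.goldenRatio := Real.log_nonneg Real.one_lt_goldenRatio.le
  have hu := Real.log_le_log hF (fib_le_goldenRatio_pow n).1
  rw [Real.log_pow] at hu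
  rw [abs_le]
  refine ⟨?_, by linarith⟩
  rcases Nat.lt_or_ge n 2 with h | h
  · obtain rfl : n = 1 := by omega
    simp
    linarith
  · obtain ⟨m, rfl⟩ := Nat.exists_eq_add_of_le' h
    have := Real.log_le_log (pow_pos hg _) (goldenRatio_pow_le_fib m).1
    rw [Real.log_pow] at this
    push_cast at *
    linarith

open ArithmeticFunction in
theorem sum_moebius_mul_eq_totient {n : ℕ} (hn : 0 < n) :
    ∑ x ∈ n.divisorsAntidiagonal, (moebius x.1 : ℝ) * x.2 = n.totient := by
  refine (sum_eq_iff_sum_mul_moebius_eq (R := ℝ) (f := fun n => (n.totient : ℝ))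
    (g := fun n => (n : ℝ))).1 (fun n _ => ?_) n hn
  exact_mod_cast Nat.sum_totient n

open ArithmeticFunction in
/-- Möbius inversion of `F_n = ∏_{d ∣ n} C_d` gives `log Cₙ = φ(n) log α + O(τ(n))`. -/
theorem abs_log_fibPrimitivePart_sub_le {n : ℕ} (hn : 0 < n) :
    |Real.log (fibPrimitivePart n) - n.totient * Real.log Real.goldenRatio| ≤
      2 * Real.log Real.goldenRatio * n.divisors.card := by
  have h1 : ∑ x ∈ n.divisorsAntidiagonal, (moebius x.1 : ℝ) * Real.log (Nat.fib x.2) =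
      Real.log (fibPrimitivePart n) := by
    refine (sum_eq_iff_sum_mul_moebius_eq (R := ℝ)
      (f := fun n => Real.log (fibPrimitivePart n))
      (g := fun n => Real.log (Nat.fib n))).1 (fun n hn => ?_) n hn
    rw [← prod_divisors_fibPrimitivePart hn, Nat.cast_prod, Real.log_prod]
    intro d hd
    exact_mod_cast (fibPrimitivePart_pos (Nat.pos_of_mem_divisors hd)).ne'
  rw [← h1, ← sum_moebius_mul_eq_totient hn, Finset.sum_mul, ← Finset.sum_sub_distrib]
  refine (Finset.abs_sum_le_sum_abs _ _).trans ?_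
  rw [← Nat.map_div_right_divisors, Finset.sum_map]
  rw [mul_comm, ← nsmul_eq_mul]
  refine Finset.sum_le_card_nsmul _ _ _ fun d hd => ?_
  have hd2 : 0 < n / d := Nat.div_pos (Nat.divisor_le hd) (Nat.pos_of_mem_divisors hd)
  change |(moebius d : ℝ) * Real.log (Nat.fib (n / d)) -
    (moebius d : ℝ) * ((n / d : ℕ) : ℝ) * Real.log Real.goldenRatio| ≤ _
  rw [mul_assoc, ← mul_sub, abs_mul]
  have hμ : |(moebius d : ℝ)| ≤ 1 := by exact_mod_cast abs_moebius_le_one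
  calc _ ≤ 1 * (2 * Real.log Real.goldenRatio) :=
        mul_le_mul hμ (abs_log_fib_sub_le hd2) (abs_nonneg _) zero_le_one
    _ = _ := one_mul _

/-! ### Factoring the shifted Fibonacci numbers -/

/-- The Lucas number `L_b`, written through Fibonacci numbers as `2 F_{b+1} - F_b`
(the subtraction does not truncate). -/
def fibLucas (b : ℕ) : ℕ := 2 * Nat.fib (b + 1) - Nat.fib b

theorem coe_fibLucas (b : ℕ) : (fibLucas b : ℤ) = 2 * Nat.fib (b + 1) - Nat.fib b := by
  have : Nat.fib b ≤ Nat.fib (b + 1) := Nat.fib_le_fib_succ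
  rw [fibLucas, Nat.cast_sub (by omega)]
  push_cast
  ring

theorem prod_sdiff_divisors_fibPrimitivePart {b : ℕ} (hb : 0 < b) :
    ∏ d ∈ (2 * b).divisors \ b.divisors, fibPrimitivePart d = fibLucas b := by
  have hsub : b.divisors ⊆ (2 * b).divisors :=
    Nat.divisors_subset_of_dvd (by omega) (Dvd.intro_left 2 rfl)
  have h := Finset.prod_sdiff hsub (f := fibPrimitivePart)
  rw [prod_divisors_fibPrimitivePart hb, prod_divisors_fibPrimitivePart (by omega),
    Nat.fib_two_mul, mul_comm] at h
  exact Nat.eq_of_mul_eq_mul_left (Nat.fib_pos.2 hb) h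

theorem fib_cassini (l : ℕ) :
    (Nat.fib (l + 1) : ℤ) ^ 2 - Nat.fib (l + 1) * Nat.fib l - (Nat.fib l : ℤ) ^ 2 = (-1) ^ l := by
  induction l with
  | zero => simp
  | succ l ih =>
    rw [pow_succ (-1 : ℤ), ← ih, Nat.fib_add_two]
    push_cast
    ring

/-- The indices `(a, b)` with `F_k + s = F_a L_b` for `s = ±1`. They are
`(k - 1) / 2` and `k / 2 + 1`, in an order that depends on `s` and on the parity of
`(k - 1) / 2`. -/
def shiftedFibIndices (k : ℕ) (s : ℤ) : ℕ × ℕ :=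
  if s = (-1) ^ ((k - 1) / 2) then (k / 2 + 1, (k - 1) / 2) else ((k - 1) / 2, k / 2 + 1)

theorem fib_add_sign_eq {k : ℕ} (hk : 0 < k) {s : ℤ} (hs : s = 1 ∨ s = -1) :
    (Nat.fib k : ℤ) + s =
      ((Nat.fib (shiftedFibIndices k s).1 * fibLucas (shiftedFibIndices k s).2 : ℕ) : ℤ) := by
  have hC := fib_cassini ((k - 1) / 2)
  set l := (k - 1) / 2 with hl
  have hs' : s = (-1) ^ l ∨ s = -(-1) ^ l := by
    rcases neg_one_pow_eq_or ℤ l with h | h <;> rcases hs with rfl | rfl <;> simp [h]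
  have hne : -(-1 : ℤ) ^ l ≠ (-1) ^ l := by
    rcases neg_one_pow_eq_or ℤ l with h | h <;> rw [h] <;> norm_num
  have hk' : k = 2 * l + 1 ∨ k = 2 * l + 2 := by omega
  rcases hs' with rfl | rfl
  · rw [shiftedFibIndices, ← hl, if_pos rfl, ← hC]
    rcases hk' with hk' | hk'
    · rw [show k / 2 + 1 = l + 1 by omega, hk', Nat.fib_two_mul_add_one]
      push_cast
      rw [coe_fibLucas]
      ring
    · rw [show k / 2 + 1 = l + 2 by omega, hk', Nat.fib_two_mul_add_two, Nat.fib_add_two]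
      push_cast
      rw [coe_fibLucas]
      ring
  · rw [shiftedFibIndices, ← hl, if_neg hne, ← hC]
    rcases hk' with hk' | hk'
    · rw [show k / 2 + 1 = l + 1 by omega, hk', Nat.fib_two_mul_add_one]
      push_cast
      rw [coe_fibLucas, Nat.fib_add_two]
      push_cast
      ring
    · rw [show k / 2 + 1 = l + 2 by omega, hk', Nat.fib_two_mul_add_two]
      push_cast
      rw [coe_fibLucas, Nat.fib_add_two, Nat.fib_add_two]
      push_cast
      ring

theorem shiftedFibIndices_cases (k : ℕ) (s : ℤ) :
    shiftedFibIndices k s = (k / 2 + 1, (k - 1) / 2) ∨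
      shiftedFibIndices k s = ((k - 1) / 2, k / 2 + 1) := by
  unfold shiftedFibIndices
  split_ifs <;> simp

/-- The two signs give the two orders of the pair of indices. -/
theorem shiftedFibIndices_neg_one (k : ℕ) :
    shiftedFibIndices k (-1) = (shiftedFibIndices k 1).swap := by
  unfold shiftedFibIndices
  rcases neg_one_pow_eq_or ℤ ((k - 1) / 2) with h | h <;> rw [h] <;> norm_num

/-- The indices `d` of the primitive parts `C_d` that occur in `F_a L_b`, for `p = (a, b)`: those in
`F_a = ∏_{d ∣ a} C_d`, and those in `L_b = F_{2b} / F_b = ∏_{d ∣ 2b, d ∤ b} C_d`. -/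
def primitiveIndices (p : ℕ × ℕ) : Finset ℕ := p.1.divisors ∪ ((2 * p.2).divisors \ p.2.divisors)

/-- Up to the factor `3 = C₁C₂C₄`, the number `F_a L_b` divides the product of its primitive
parts. The factor is needed because `C₄ = 3` may occur both in `F_a` and in `L_b`. -/
theorem fib_mul_fibLucas_dvd {a b : ℕ} (ha : 0 < a) (hb : 0 < b) {j : ℕ} (hj : j = 1 ∨ j = 2)
    (hab : a = b + j ∨ b = a + j) :
    Nat.fib a * fibLucas b ∣ 3 * ∏ d ∈ primitiveIndices (a, b), fibPrimitivePart d := by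
  rw [← prod_divisors_fibPrimitivePart ha, ← prod_sdiff_divisors_fibPrimitivePart hb,
    ← Finset.prod_union_inter, mul_comm]
  refine mul_dvd_mul_right ?_ _
  have h4 : (3 : ℕ) = ∏ d ∈ Nat.divisors 4, fibPrimitivePart d := by
    rw [prod_divisors_fibPrimitivePart (by norm_num)]
    norm_num [Nat.fib_add_two]
  rw [h4]
  refine Finset.prod_dvd_prod_of_subset _ _ _ fun d hd => ?_
  simp only [mem_inter, mem_sdiff, Nat.mem_divisors] at hd
  refine Nat.mem_divisors.2 ⟨?_, by norm_num⟩
  have h1 : d ∣ 2 * a := hd.1.1.mul_left 2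
  have h2 : d ∣ 2 * b := hd.2.1.1
  have h3 : d ∣ 2 * j := by
    rcases hab with rfl | rfl
    · rw [mul_add] at h1
      exact (Nat.dvd_add_right h2).1 h1
    · rw [mul_add] at h2
      exact (Nat.dvd_add_right h1).1 h2
  refine h3.trans ?_
  rcases hj with rfl | rfl <;> norm_num

theorem fibPrimitivePart_dvd_fib_mul_fibLucas {a b d : ℕ} (ha : 0 < a) (hb : 0 < b)
    (hd : d ∈ primitiveIndices (a, b)) : fibPrimitivePart d ∣ Nat.fib a * fibLucas b := by
  rw [← prod_divisors_fibPrimitivePart ha, ← prod_sdiff_divisors_fibPrimitivePart hb]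
  rcases mem_union.1 hd with h | h
  · exact (Finset.dvd_prod_of_mem _ h).mul_right _
  · exact (Finset.dvd_prod_of_mem _ h).mul_left _

/-- The indices of the primitive parts that occur in one of `F₃ + s₃, …, F_n + s_n`. -/
def shiftedIndices (s : ℕ → ℤ) (n : ℕ) : Finset ℕ :=
  (Icc 3 n).biUnion fun k => primitiveIndices (shiftedFibIndices k (s k))

theorem shiftedIndices_subset (s : ℕ → ℤ) (n : ℕ) : shiftedIndices s n ⊆ Icc 1 (n + 2) := by
  intro d hd
  obtain ⟨k, hk, hd⟩ := mem_biUnion.1 hd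
  rw [mem_Icc] at hk
  rcases mem_union.1 hd with h | h
  · have h1 := Nat.pos_of_mem_divisors h
    have h2 := Nat.divisor_le h
    rw [mem_Icc]
    rcases shiftedFibIndices_cases k (s k) with e | e <;> rw [e] at h2 <;> dsimp only at h2 <;>
      omega
  · have h := (mem_sdiff.1 h).1
    have h1 := Nat.pos_of_mem_divisors h
    have h2 := Nat.divisor_le h
    rw [mem_Icc]
    rcases shiftedFibIndices_cases k (s k) with e | e <;> rw [e] at h2 <;> dsimp only at h2 <;>
      omega

/-- The upper half of the comparison of the lcm with the product of the primitive parts that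
occur. -/
theorem shiftedFibLcm_dvd {s : ℕ → ℤ} (hs : ∀ k, 3 ≤ k → s k = 1 ∨ s k = -1) (n : ℕ) :
    shiftedFibLcm s n ∣
    ((3 * ∏ d ∈ shiftedIndices s n, fibPrimitivePart d : ℕ) : ℤ) := by
  refine Finset.lcm_dvd fun k hk => ?_
  have hk3 := (mem_Icc.1 hk).1
  rw [fib_add_sign_eq (by omega) (hs k hk3), Int.natCast_dvd_natCast]
  have hsub : primitiveIndices (shiftedFibIndices k (s k)) ⊆ shiftedIndices s n :=
    Finset.subset_biUnion_of_mem (fun k => primitiveIndices (shiftedFibIndices k (s k))) hk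
  refine dvd_trans ?_ (mul_dvd_mul_left 3 (Finset.prod_dvd_prod_of_subset _ _ _ hsub))
  rcases Nat.even_or_odd' k with ⟨c, rfl | rfl⟩
  · rcases shiftedFibIndices_cases (2 * c) (s (2 * c)) with e | e <;> rw [e] <;>
      exact fib_mul_fibLucas_dvd (by omega) (by omega) (Or.inr rfl) (by omega)
  · rcases shiftedFibIndices_cases (2 * c + 1) (s (2 * c + 1)) with e | e <;> rw [e] <;>
      exact fib_mul_fibLucas_dvd (by omega) (by omega) (Or.inl rfl) (by omega)

theorem dvd_shiftedFibLcm {s : ℕ → ℤ} (hs : ∀ k, 3 ≤ k → s k = 1 ∨ s k = -1) (n : ℕ) :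
   
    (((shiftedIndices s n).lcm fibPrimitivePart : ℕ) : ℤ) ∣ shiftedFibLcm s n := by
  rw [Int.natCast_dvd]
  refine Finset.lcm_dvd fun d hd => ?_
  obtain ⟨k, hk, hd⟩ := mem_biUnion.1 hd
  rw [← Int.natCast_dvd]
  have hk3 := (mem_Icc.1 hk).1
  refine dvd_trans ?_ (Finset.dvd_lcm hk)
  rw [fib_add_sign_eq (by omega) (hs k hk3), Int.natCast_dvd_natCast]
  rcases shiftedFibIndices_cases k (s k) with e | e <;> rw [e] at hd ⊢ <;>
    exact fibPrimitivePart_dvd_fib_mul_fibLucas (by omega) (by omega) hd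

theorem shiftedFibLcm_pos {s : ℕ → ℤ} (hs : ∀ k, 3 ≤ k → s k = 1 ∨ s k = -1) (n : ℕ) :
    0 < shiftedFibLcm s n := by
  have h1 : 0 ≤ shiftedFibLcm s n := Int.nonneg_of_normalize_eq_self Finset.normalize_lcm
  refine lt_of_le_of_ne h1 fun h => ?_
  have hdvd := shiftedFibLcm_dvd hs n
  rw [← h, zero_dvd_iff] at hdvd
  have hpos : 0 < 3 * ∏ d ∈ shiftedIndices s n, fibPrimitivePart d :=
    Nat.mul_pos (by norm_num) <| Finset.prod_pos fun d hd =>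
      fibPrimitivePart_pos (mem_Icc.1 (shiftedIndices_subset s n hd)).1
  exact hpos.ne' (by exact_mod_cast hdvd)

theorem log_shiftedFibLcm_le {s : ℕ → ℤ} (hs : ∀ k, 3 ≤ k → s k = 1 ∨ s k = -1) (n : ℕ) :
    Real.log (shiftedFibLcm s n : ℝ) ≤
    ∑ d ∈ shiftedIndices s n, Real.log (fibPrimitivePart d) + Real.log 3 := by
  have hpos : ∀ d ∈ shiftedIndices s n, 0 < fibPrimitivePart d := fun d hd =>
    fibPrimitivePart_pos (mem_Icc.1 (shiftedIndices_subset s n hd)).1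
  have hprod := Finset.prod_pos hpos
  have hdvd := shiftedFibLcm_dvd hs n
  have hle := Int.le_of_dvd (by exact_mod_cast (by positivity)) hdvd
  have hle' : (shiftedFibLcm s n : ℝ) ≤
      3 * ∏ d ∈ shiftedIndices s n, (fibPrimitivePart d : ℝ) := by exact_mod_cast hle
  have h0 := shiftedFibLcm_pos hs n
  refine (Real.log_le_log (by exact_mod_cast h0) hle').trans (le_of_eq ?_)
  have hprod' : (∏ d ∈ shiftedIndices s n, (fibPrimitivePart d : ℝ)) ≠ 0 := by
    exact_mod_cast hprod.ne'
  rw [Real.log_mul (by norm_num) hprod', add_comm, Real.log_prod]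
  intro d hd
  exact_mod_cast (hpos d hd).ne'

theorem le_log_shiftedFibLcm {s : ℕ → ℤ} (hs : ∀ k, 3 ≤ k → s k = 1 ∨ s k = -1) (n : ℕ) :
    ∑ d ∈ shiftedIndices s n, Real.log (fibPrimitivePart d) -
    ∑ e ∈ Icc 1 (n + 2), (e.divisors.card : ℝ) * Real.log e ≤
      Real.log (shiftedFibLcm s n : ℝ) := by
  have hidx : ∀ d ∈ shiftedIndices s n, 0 < d := fun d hd =>
    (mem_Icc.1 (shiftedIndices_subset s n hd)).1
  have hpos : ∀ d ∈ shiftedIndices s n, 0 < fibPrimitivePart d := fun d hd =>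
    fibPrimitivePart_pos (hidx d hd)
  have hprod := Finset.prod_pos hpos
  have hZ := shiftedFibLcm_pos hs n
  have hle := Int.le_of_dvd hZ (dvd_shiftedFibLcm hs n)
  have h1 : (∏ d ∈ shiftedIndices s n, (fibPrimitivePart d : ℝ)) ≤
      (shiftedFibLcm s n : ℝ) * ∏ e ∈ shiftedIndices s n, (e : ℝ) ^ e.divisors.card := by
    calc (∏ d ∈ shiftedIndices s n, (fibPrimitivePart d : ℝ))
        ≤ (((shiftedIndices s n).lcm fibPrimitivePart : ℕ) : ℝ) *
          ∏ e ∈ shiftedIndices s n, (e : ℝ) ^ e.divisors.card := by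
          exact_mod_cast prod_fibPrimitivePart_le _ hidx
      _ ≤ _ := by
          gcongr
          exact_mod_cast hle
  have hpow : ∀ e ∈ shiftedIndices s n, (e : ℝ) ^ e.divisors.card ≠ 0 := fun e he =>
    pow_ne_zero _ (by exact_mod_cast (hidx e he).ne')
  have h2 := Real.log_le_log (by exact_mod_cast hprod) h1
  rw [Real.log_mul (by exact_mod_cast hZ.ne') (Finset.prod_ne_zero_iff.2 hpow),
    Real.log_prod (fun d hd => by exact_mod_cast (hpos d hd).ne'), Real.log_prod hpow] at h2
  have h3 : ∑ e ∈ shiftedIndices s n, Real.log ((e : ℝ) ^ e.divisors.card) ≤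
      ∑ e ∈ Icc 1 (n + 2), (e.divisors.card : ℝ) * Real.log e := by
    simp_rw [Real.log_pow]
    exact Finset.sum_le_sum_of_subset_of_nonneg (shiftedIndices_subset s n) fun e _ _ =>
      mul_nonneg (Nat.cast_nonneg _) (Real.log_natCast_nonneg e)
  linarith

/-! ### The signs for which a primitive part occurs -/

/-- The index `d` occurs in the decomposition of `F_m` or `L_m` into primitive parts exactly when
this number divides `m`. For odd `d` it occurs only in decompositions of numbers `F_m`. -/
def indexCore (d : ℕ) : ℕ := if Even d then d / 2 else d

theorem mem_primitiveIndices_of_odd {a b d : ℕ} (ha : 0 < a) (hd : Odd d) :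
    d ∈ primitiveIndices (a, b) ↔ d ∣ a := by
  simp only [primitiveIndices, mem_union, mem_sdiff, Nat.mem_divisors]
  constructor
  · rintro (h | ⟨⟨h, hb⟩, h'⟩)
    · exact h.1
    · have : d ∣ b := (Nat.coprime_two_right.2 hd).dvd_of_dvd_mul_left h
      exact absurd ⟨this, by omega⟩ h'
  · exact fun h => Or.inl ⟨h, ha.ne'⟩

theorem mem_primitiveIndices_of_even {a b e : ℕ} (ha : 0 < a) (hb : 0 < b) :
    2 * e ∈ primitiveIndices (a, b) ↔ 2 * e ∣ a ∨ (e ∣ b ∧ ¬ 2 * e ∣ b) := by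
  simp only [primitiveIndices, mem_union, mem_sdiff, Nat.mem_divisors]
  rw [Nat.mul_dvd_mul_iff_left (by norm_num : 0 < 2)]
  simp [ha.ne', hb.ne']

theorem notMem_primitiveIndices {a b d : ℕ} (ha : 0 < a) (hb : 0 < b)
    (hda : ¬ indexCore d ∣ a) (hdb : ¬ indexCore d ∣ b) : d ∉ primitiveIndices (a, b) := by
  unfold indexCore at hda hdb
  rcases Nat.even_or_odd d with h | h
  · rw [if_pos h] at hda hdb
    obtain ⟨e, rfl⟩ := h.two_dvd
    rw [Nat.mul_div_cancel_left _ (by norm_num)] at hda hdb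
    rw [mem_primitiveIndices_of_even ha hb]
    rintro (h1 | h1)
    · exact hda ((Dvd.intro_left 2 rfl).trans h1)
    · exact hdb h1.1
  · rw [if_neg (Nat.not_even_iff_odd.2 h)] at hda
    rwa [mem_primitiveIndices_of_odd ha h]

theorem not_dvd_of_close {e a b j : ℕ} (he : 3 ≤ e) (hj : j = 1 ∨ j = 2)
    (hab : a = b + j ∨ b = a + j) (hea : e ∣ a) : ¬ e ∣ b := by
  intro heb
  have : e ∣ j := by
    rcases hab with rfl | rfl
    · exact (Nat.dvd_add_right heb).1 hea
    · exact (Nat.dvd_add_right hea).1 heb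
  have := Nat.le_of_dvd (by omega) this
  omega

/-- If `a` and `b` differ by `1` or `2` and the core of `d` is at least `3` and divides `a` or `b`,
then `C_d` occurs in exactly one of `F_a L_b` and `F_b L_a`. -/
theorem mem_primitiveIndices_swap {a b d j : ℕ} (ha : 0 < a) (hb : 0 < b) (hd : 3 ≤ indexCore d)
    (hj : j = 1 ∨ j = 2) (hab : a = b + j ∨ b = a + j)
    (h : indexCore d ∣ a ∨ indexCore d ∣ b) :
    d ∈ primitiveIndices (a, b) ↔ d ∉ primitiveIndices (b, a) := by
  have h1 := not_dvd_of_close hd hj hab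
  unfold indexCore at h h1
  rcases Nat.even_or_odd d with hev | hodd
  · rw [if_pos hev] at h h1
    obtain ⟨e, rfl⟩ := hev.two_dvd
    rw [Nat.mul_div_cancel_left _ (by norm_num)] at h h1
    rw [mem_primitiveIndices_of_even ha hb, mem_primitiveIndices_of_even hb ha]
    have h2 : 2 * e ∣ a → e ∣ a := (Dvd.intro_left 2 rfl).trans
    have h3 : 2 * e ∣ b → e ∣ b := (Dvd.intro_left 2 rfl).trans
    tauto
  · rw [if_neg (Nat.not_even_iff_odd.2 hodd)] at h h1
    rw [mem_primitiveIndices_of_odd ha hodd, mem_primitiveIndices_of_odd hb hodd]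
    tauto

/-- For `d` with core `e ≥ 3`, whether the `d`-th primitive part occurs in `F_k + s` depends on the
sign: if `e` divides one of the two indices attached to `k`, exactly one of the two signs works. -/
theorem mem_primitiveIndices_sign {k d : ℕ} (hk : 3 ≤ k) (hd : 3 ≤ indexCore d)
    (h : indexCore d ∣ (k - 1) / 2 ∨ indexCore d ∣ k / 2 + 1) :
    d ∈ primitiveIndices (shiftedFibIndices k 1) ↔
      d ∉ primitiveIndices (shiftedFibIndices k (-1)) := by
  rw [shiftedFibIndices_neg_one]
  have hj : k / 2 + 1 = (k - 1) / 2 + 1 ∨ k / 2 + 1 = (k - 1) / 2 + 2 := by omega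
  rcases shiftedFibIndices_cases k 1 with e | e <;> rw [e, Prod.swap_prod_mk] <;>
    rcases hj with hj | hj
  · exact mem_primitiveIndices_swap (by omega) (by omega) hd (Or.inl rfl) (by omega) h.symm
  · exact mem_primitiveIndices_swap (by omega) (by omega) hd (Or.inr rfl) (by omega) h.symm
  · exact mem_primitiveIndices_swap (by omega) (by omega) hd (Or.inl rfl) (by omega) h
  · exact mem_primitiveIndices_swap (by omega) (by omega) hd (Or.inr rfl) (by omega) h

theorem notMem_primitiveIndices_sign {k d : ℕ} (hk : 3 ≤ k) (s : ℤ)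
    (h : ¬ (indexCore d ∣ (k - 1) / 2 ∨ indexCore d ∣ k / 2 + 1)) :
    d ∉ primitiveIndices (shiftedFibIndices k s) := by
  rw [not_or] at h
  rcases shiftedFibIndices_cases k s with e | e <;> rw [e]
  · exact notMem_primitiveIndices (by omega) (by omega) h.2 h.1
  · exact notMem_primitiveIndices (by omega) (by omega) h.1 h.2

/-! ### Counting the relevant indices -/

/-- The `k ∈ [3, n]` for which the core `e` divides an index attached to `k`, that is, the
`k ∈ [3, n]` of the form `2m ± 1` or `2m ± 2` with `e ∣ m`. -/
def relevantIndices (e n : ℕ) : Finset ℕ :=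
  {k ∈ Icc 3 n | e ∣ (k - 1) / 2 ∨ e ∣ k / 2 + 1}

/-- The four `k` that have `m` among their attached indices, for `m ≥ 1`. -/
def nearDouble (m : ℕ) : Finset ℕ := {2 * m - 2, 2 * m - 1, 2 * m + 1, 2 * m + 2}

theorem card_nearDouble {m : ℕ} (hm : 1 ≤ m) : (nearDouble m).card = 4 := by
  unfold nearDouble
  repeat rw [Finset.card_insert_of_notMem (by simp only [mem_insert, mem_singleton]; omega)]
  simp

theorem mem_nearDouble {k m : ℕ} (hm : 1 ≤ m) (hk : 1 ≤ k) :
    k ∈ nearDouble m ↔ m = (k - 1) / 2 ∨ m = k / 2 + 1 := by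
  simp only [nearDouble, mem_insert, mem_singleton]
  omega

/-- For `e ≥ 3` the multiples of `2e` are at least `6` apart, so these blocks of four do not
overlap. -/
theorem card_biUnion_nearDouble {e : ℕ} (he : 3 ≤ e) (r : ℕ) :
    ((Icc 1 r).biUnion fun i => nearDouble (e * i)).card = 4 * r := by
  rw [Finset.card_biUnion]
  · rw [Finset.sum_congr rfl fun i hi => card_nearDouble (by
      have := (mem_Icc.1 hi).1
      nlinarith)]
    simp [mul_comm]
  · intro i _ j _ hij
    rw [Function.onFun, Finset.disjoint_left]
    intro k hk hk'
    simp only [nearDouble, mem_insert, mem_singleton] at hk hk'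
    rcases Nat.lt_or_gt_of_ne hij with h | h
    · have : e * i + e ≤ e * j := by nlinarith
      omega
    · have : e * j + e ≤ e * i := by nlinarith
      omega

theorem le_card_relevantIndices {e : ℕ} (he : 3 ≤ e) (n : ℕ) :
    4 * ((n - 2) / (2 * e)) ≤ (relevantIndices e n).card := by
  rw [← card_biUnion_nearDouble he]
  refine Finset.card_le_card fun k hk => ?_
  obtain ⟨i, hi, hk⟩ := mem_biUnion.1 hk
  rw [mem_Icc] at hi
  have h1 : 2 * e * i ≤ n - 2 := (Nat.mul_le_mul_left _ hi.2).trans (Nat.mul_div_le _ _)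
  have h2 : e ≤ e * i := Nat.le_mul_of_pos_right _ hi.1
  have hm : 3 ≤ e * i := he.trans h2
  rw [mul_assoc] at h1
  have hk' : 3 ≤ k ∧ k ≤ n := by
    simp only [nearDouble, mem_insert, mem_singleton] at hk
    omega
  rw [mem_nearDouble (by omega) (by omega)] at hk
  refine mem_filter.2 ⟨mem_Icc.2 hk', ?_⟩
  rcases hk with h | h <;> rw [← h]
  · exact Or.inl (Dvd.intro _ rfl)
  · exact Or.inr (Dvd.intro _ rfl)

theorem card_relevantIndices_le {e : ℕ} (he : 3 ≤ e) (n : ℕ) :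
    (relevantIndices e n).card ≤ 4 * ((n + 2) / (2 * e)) := by
  rw [← card_biUnion_nearDouble he]
  refine Finset.card_le_card fun k hk => ?_
  obtain ⟨hk, h⟩ := mem_filter.1 hk
  rw [mem_Icc] at hk
  obtain ⟨m, hm, hem⟩ : ∃ m, (m = (k - 1) / 2 ∨ m = k / 2 + 1) ∧ e ∣ m := by
    rcases h with h | h
    · exact ⟨_, Or.inl rfl, h⟩
    · exact ⟨_, Or.inr rfl, h⟩
  obtain ⟨i, rfl⟩ := hem
  have hi : 1 ≤ i := by
    rcases Nat.eq_zero_or_pos i with rfl | hi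
    · omega
    · exact hi
  refine mem_biUnion.2 ⟨i, mem_Icc.2 ⟨hi, ?_⟩, (mem_nearDouble (by omega) (by omega)).2 hm⟩
  rw [Nat.le_div_iff_mul_le (by omega)]
  have : i * (2 * e) = 2 * (e * i) := by ring
  omega

open Filter Topology

/-! ### Totient sums -/

theorem tendsto_comp_div_sq {f : ℕ → ℝ} {L ρ : ℝ}
    (hf : Tendsto (fun N : ℕ => f N / (N : ℝ) ^ 2) atTop (𝓝 L)) {a : ℕ → ℕ}
    (ha : Tendsto a atTop atTop) (hρ : Tendsto (fun n : ℕ => (a n : ℝ) / n) atTop (𝓝 ρ)) :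
    Tendsto (fun n : ℕ => f (a n) / (n : ℝ) ^ 2) atTop (𝓝 (L * ρ ^ 2)) := by
  refine ((hf.comp ha).mul (hρ.pow 2)).congr' ?_
  filter_upwards [ha.eventually_gt_atTop 0] with n hn
  have : (a n : ℝ) ≠ 0 := by exact_mod_cast hn.ne'
  simp only [Function.comp_apply]
  rw [div_pow, div_mul_div_cancel₀ (pow_ne_zero 2 this)]

theorem tendsto_natDiv_div (d : ℕ) :
    Tendsto (fun N : ℕ => ((N / d : ℕ) : ℝ) / N) atTop (𝓝 (1 / (d : ℝ))) := by
  have h : (0 : ℝ) ≤ 1 / (d : ℝ) := by positivity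
  refine ((tendsto_nat_floor_mul_div_atTop h).comp tendsto_natCast_atTop_atTop).congr fun N => ?_
  simp only [Function.comp_apply]
  rw [one_div_mul_eq_div, Nat.floor_div_eq_div]

theorem natDiv_div_le (N d : ℕ) : ((N / d : ℕ) : ℝ) / N ≤ 1 / (d : ℝ) := by
  have h : ((N / d : ℕ) : ℝ) ≤ N / d := Nat.cast_div_le
  rcases Nat.eq_zero_or_pos N with rfl | hN
  · simp
  · rw [div_le_iff₀ (by exact_mod_cast hN), one_div_mul_eq_div]
    exact h

open ArithmeticFunction in
theorem sum_totient_eq_sum_moebius (N : ℕ) : ∑ n ∈ Ioc 0 N, (n.totient : ℝ) =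
    ∑ d ∈ Ioc 0 N, (moebius d : ℝ) * (((N / d : ℕ) : ℝ) * (((N / d : ℕ) : ℝ) + 1) / 2) := by
  have hid : ∀ M : ℕ, ∑ m ∈ Ioc 0 M, (m : ℝ) = (M : ℝ) * ((M : ℝ) + 1) / 2 := by
    intro M
    induction M with
    | zero => simp
    | succ M ih =>
      rw [Finset.sum_Ioc_succ_top (Nat.zero_le M), ih]
      push_cast
      ring
  have h := sum_Ioc_mul_eq_sum_sum (R := ℝ)
    ((moebius : ArithmeticFunction ℤ) : ArithmeticFunction ℝ)
    ((ArithmeticFunction.id : ArithmeticFunction ℕ) : ArithmeticFunction ℝ) N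
  simp only [natCoe_apply, id_apply, hid, intCoe_apply] at h
  rw [← h]
  refine Finset.sum_congr rfl fun n hn => ?_
  rw [← sum_moebius_mul_eq_totient (mem_Ioc.1 hn).1, mul_apply]
  simp

open ArithmeticFunction in
theorem tsum_moebius_div_sq : ∑' d : ℕ, (moebius d : ℝ) / (d : ℝ) ^ 2 = 6 / Real.pi ^ 2 := by
  have h := LSeries_zeta_mul_Lseries_moebius (s := 2) (by norm_num)
  rw [LSeries_zeta_eq_riemannZeta (by norm_num), riemannZeta_two] at h
  have h2 : LSeries (fun n => (moebius n : ℂ)) 2 =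
      ((∑' d : ℕ, (moebius d : ℝ) / (d : ℝ) ^ 2 : ℝ) : ℂ) := by
    rw [LSeries, Complex.ofReal_tsum]
    refine tsum_congr fun n => ?_
    rcases eq_or_ne n 0 with rfl | hn
    · simp
    · rw [LSeries.term_of_ne_zero hn]
      push_cast
      norm_cast
  rw [h2] at h
  have h3 : Real.pi ^ 2 / 6 * ∑' d : ℕ, (moebius d : ℝ) / (d : ℝ) ^ 2 = 1 := by
    exact_mod_cast h
  have := Real.pi_pos
  field_simp at h3 ⊢
  linarith

open ArithmeticFunction in
/-- `∑_{n ≤ N} φ(n) ∼ 3 N² / π²`, by dominated convergence in the sum over `d` of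
`sum_totient_eq_sum_moebius`. -/
theorem tendsto_sum_totient_div_sq :
    Tendsto (fun N : ℕ => (∑ n ∈ Ioc 0 N, (n.totient : ℝ)) / (N : ℝ) ^ 2) atTop
      (𝓝 (3 / Real.pi ^ 2)) := by
  set f : ℕ → ℕ → ℝ := fun N d => (moebius d : ℝ) *
    (((N / d : ℕ) : ℝ) / N * (((N / d : ℕ) : ℝ) / N + 1 / (N : ℝ)) / 2) with hf
  have hsum : ∀ N : ℕ, (∑ n ∈ Ioc 0 N, (n.totient : ℝ)) / (N : ℝ) ^ 2 = ∑' d, f N d := by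
    intro N
    rw [tsum_eq_sum (s := Ioc 0 N), sum_totient_eq_sum_moebius, Finset.sum_div]
    · refine Finset.sum_congr rfl fun d hd => ?_
      have : (N : ℝ) ≠ 0 := by
        have := mem_Ioc.1 hd
        exact_mod_cast (by omega : N ≠ 0)
      simp only [hf]
      field_simp
    · intro d hd
      have : N / d = 0 := by
        rw [mem_Ioc, not_and_or] at hd
        rw [Nat.div_eq_zero_iff]
        omega
      simp [hf, this]
  have hlim : 3 / Real.pi ^ 2 = ∑' d : ℕ, (moebius d : ℝ) *
      (1 / (d : ℝ) * (1 / (d : ℝ) + 0) / 2) := by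
    have h := tsum_moebius_div_sq
    calc 3 / Real.pi ^ 2 = (∑' d : ℕ, (moebius d : ℝ) / (d : ℝ) ^ 2) * (1 / 2) := by rw [h]; ring
      _ = _ := by
        rw [← tsum_mul_right]
        refine tsum_congr fun d => ?_
        ring
  simp_rw [hsum]
  rw [hlim]
  refine tendsto_tsum_of_dominated_convergence (bound := fun d : ℕ => 1 / (d : ℝ) ^ 2)
    (Real.summable_one_div_nat_pow.2 (by norm_num)) (fun d => ?_)
    (Eventually.of_forall fun N d => ?_)
  · exact (((tendsto_natDiv_div d).mul ((tendsto_natDiv_div d).add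
      tendsto_one_div_atTop_nhds_zero_nat)).div_const 2).const_mul _
  · have hμ : |(moebius d : ℝ)| ≤ 1 := by exact_mod_cast abs_moebius_le_one
    have h1 := natDiv_div_le N d
    have h0 : 0 ≤ ((N / d : ℕ) : ℝ) / N := by positivity
    -- `q (q + 1) / 2 ≤ q ^ 2` for natural numbers `q`
    have h2 : ((N / d : ℕ) : ℝ) / N * (((N / d : ℕ) : ℝ) / N + 1 / (N : ℝ)) / 2 ≤
        (((N / d : ℕ) : ℝ) / N) ^ 2 := by
      rcases Nat.eq_zero_or_pos (N / d) with h | h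
      · simp [h]
      · have h3 : 1 / (N : ℝ) ≤ ((N / d : ℕ) : ℝ) / N := by
          gcongr
          exact_mod_cast h
        nlinarith
    have h4 : (0 : ℝ) ≤ 1 / (N : ℝ) := by positivity
    rw [Real.norm_eq_abs, hf, abs_mul, abs_of_nonneg (a := _ / 2) (by positivity)]
    calc _ ≤ 1 * (((N / d : ℕ) : ℝ) / N) ^ 2 := by gcongr
      _ ≤ 1 * (1 / (d : ℝ)) ^ 2 := by gcongr
      _ = 1 / (d : ℝ) ^ 2 := by rw [one_mul, one_div_pow]

theorem sum_totient_le_sq (N : ℕ) : ∑ n ∈ Ioc 0 N, (n.totient : ℝ) ≤ (N : ℝ) ^ 2 := by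
  calc ∑ n ∈ Ioc 0 N, (n.totient : ℝ) ≤ ∑ n ∈ Ioc 0 N, (N : ℝ) :=
        Finset.sum_le_sum fun n hn => by
          exact_mod_cast (Nat.totient_le n).trans (mem_Ioc.1 hn).2
    _ = _ := by simp [sq]

theorem one_sub_inv_pow_eq_sum (q : ℕ) :
    1 - (1 / 16 : ℝ) ^ q = ∑ j ∈ range q, 15 * (1 / 16 : ℝ) ^ (j + 1) := by
  induction q with
  | zero => simp
  | succ q ih =>
    rw [Finset.sum_range_succ, ← ih]
    ring

/-- Grouping the totients by the value of `⌊N / 2e⌋` turns the weighted sum into a combination of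
plain totient sums. -/
theorem sum_totient_weighted_eq (N : ℕ) :
    ∑ e ∈ Ioc 0 N, 2 * (e.totient : ℝ) * (1 - (1 / 16 : ℝ) ^ (N / (2 * e))) =
      ∑ j ∈ range N, 30 * (1 / 16 : ℝ) ^ (j + 1) *
        ∑ e ∈ Ioc 0 (N / (2 * (j + 1))), (e.totient : ℝ) := by
  simp_rw [one_sub_inv_pow_eq_sum, Finset.mul_sum]
  rw [Finset.sum_comm' (t' := range N) (s' := fun j => Ioc 0 (N / (2 * (j + 1))))]
  · refine Finset.sum_congr rfl fun j _ => Finset.sum_congr rfl fun e _ => ?_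
    ring
  · intro e j
    simp only [mem_Ioc, mem_range]
    have key : 0 < e → (j < N / (2 * e) ↔ e ≤ N / (2 * (j + 1))) := fun he => by
      rw [← Nat.succ_le_iff, Nat.le_div_iff_mul_le (by omega), Nat.le_div_iff_mul_le (by omega),
        Nat.succ_eq_add_one, show (j + 1) * (2 * e) = e * (2 * (j + 1)) by ring]
    constructor
    · rintro ⟨⟨he, heN⟩, hj⟩
      exact ⟨⟨he, (key he).1 hj⟩, hj.trans_le (Nat.div_le_self _ _)⟩
    · rintro ⟨⟨he, hej⟩, -⟩
      have := (key he).2 hej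
      exact ⟨⟨he, hej.trans (Nat.div_le_self _ _)⟩, this⟩

/-- Dominated convergence in the sum over `j` of `sum_totient_weighted_eq`; this is where the
dilogarithm comes from. -/
theorem tendsto_sum_totient_weighted :
    Tendsto (fun N : ℕ => (∑ e ∈ Ioc 0 N,
      2 * (e.totient : ℝ) * (1 - (1 / 16 : ℝ) ^ (N / (2 * e)))) / (N : ℝ) ^ 2) atTop
      (𝓝 (3 / Real.pi ^ 2 * (15 * dilog (1 / 16) / 2))) := by
  set f : ℕ → ℕ → ℝ := fun N j => 30 * (1 / 16 : ℝ) ^ (j + 1) *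
    ((∑ e ∈ Ioc 0 (N / (2 * (j + 1))), (e.totient : ℝ)) / (N : ℝ) ^ 2) with hf
  have hsum : ∀ N : ℕ, (∑ e ∈ Ioc 0 N,
      2 * (e.totient : ℝ) * (1 - (1 / 16 : ℝ) ^ (N / (2 * e)))) / (N : ℝ) ^ 2 = ∑' j, f N j := by
    intro N
    rw [tsum_eq_sum (s := range N), sum_totient_weighted_eq, Finset.sum_div]
    · refine Finset.sum_congr rfl fun j _ => ?_
      rw [hf, mul_div_assoc]
    · intro j hj
      have : N / (2 * (j + 1)) = 0 := by
        rw [mem_range] at hj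
        rw [Nat.div_eq_zero_iff]
        omega
      simp [hf, this]
  have hlim : 3 / Real.pi ^ 2 * (15 * dilog (1 / 16) / 2) = ∑' j : ℕ, 30 * (1 / 16 : ℝ) ^ (j + 1) *
      (3 / Real.pi ^ 2 * (1 / ((2 * (j + 1) : ℕ) : ℝ)) ^ 2) := by
    calc _ = (3 / Real.pi ^ 2 * (15 / 2)) * dilog (1 / 16) := by ring
      _ = _ := by
        rw [dilog, ← tsum_mul_left]
        refine tsum_congr fun j => ?_
        push_cast
        have : (j : ℝ) + 1 ≠ 0 := by positivity
        field_simp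
        norm_num
  simp_rw [hsum]
  rw [hlim]
  refine tendsto_tsum_of_dominated_convergence (bound := fun j : ℕ => 30 * (1 / 16 : ℝ) ^ (j + 1))
    ?_ (fun j => ?_) (Eventually.of_forall fun N j => ?_)
  · exact (((summable_geometric_of_lt_one (by norm_num) (by norm_num)).comp_injective
      (add_left_injective 1))).mul_left 30
  · refine (tendsto_comp_div_sq tendsto_sum_totient_div_sq ?_ (tendsto_natDiv_div _)).const_mul _
    exact Nat.tendsto_div_const_atTop (by omega)
  · rw [Real.norm_eq_abs, abs_of_nonneg (by positivity)]
    refine mul_le_of_le_one_right (by positivity) ?_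
    refine div_le_one_of_le₀ ((sum_totient_le_sq _).trans ?_) (by positivity)
    gcongr
    exact Nat.div_le_self _ _

/-! ### Regrouping totients by the core -/

theorem indexCore_pos {d : ℕ} (hd : 0 < d) : 0 < indexCore d := by
  unfold indexCore
  split_ifs with h
  · obtain ⟨e, rfl⟩ := h
    omega
  · exact hd

theorem le_two_mul_indexCore (d : ℕ) : d ≤ 2 * indexCore d := by
  unfold indexCore
  split_ifs with h
  · obtain ⟨e, rfl⟩ := h
    omega
  · omega

theorem indexCore_le (d : ℕ) : indexCore d ≤ d := by
  unfold indexCore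
  split_ifs <;> omega

/-- The indices with core `e` are `2e` and, for odd `e`, also `e`; their totients add up to
`2 φ(e)` in both cases. -/
theorem sum_totient_indexCore_eq {N e : ℕ} (he : 0 < e) (heN : e ≤ N) :
    ∑ d ∈ Ioc 0 (2 * N) with indexCore d = e, (d.totient : ℝ) = 2 * e.totient := by
  rcases Nat.even_or_odd e with h | h
  · have : {d ∈ Ioc 0 (2 * N) | indexCore d = e} = {2 * e} := by
      ext d
      simp only [mem_singleton, indexCore]
      grind
    rw [this, Finset.sum_singleton, Nat.totient_two_mul_of_even h]
    push_cast
    rfl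
  · have : {d ∈ Ioc 0 (2 * N) | indexCore d = e} = {e, 2 * e} := by
      ext d
      simp only [mem_singleton, Finset.mem_insert, indexCore]
      grind
    rw [this, Finset.sum_pair (by omega), Nat.totient_two_mul_of_odd h]
    ring

/-- Regrouping by the core of the index. The terms with `d > N` vanish, as `d ≤ 2 * indexCore d`. -/
theorem sum_totient_indexCore_weighted {N R : ℕ} (hR : N ≤ R) :
    ∑ d ∈ Ioc 0 R, (d.totient : ℝ) * (1 - (1 / 16 : ℝ) ^ (N / (2 * indexCore d))) =
      ∑ e ∈ Ioc 0 N, 2 * (e.totient : ℝ) * (1 - (1 / 16 : ℝ) ^ (N / (2 * e))) := by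
  have hR' : ∀ R, N ≤ R →
      ∑ d ∈ Ioc 0 R, (d.totient : ℝ) * (1 - (1 / 16 : ℝ) ^ (N / (2 * indexCore d))) =
      ∑ d ∈ Ioc 0 N, (d.totient : ℝ) * (1 - (1 / 16 : ℝ) ^ (N / (2 * indexCore d))) := by
    intro R hR
    refine (Finset.sum_subset (Ioc_subset_Ioc_right hR) fun d hd hd' => ?_).symm
    have h : N / (2 * indexCore d) = 0 := by
      rw [mem_Ioc] at hd hd'
      rw [Nat.div_eq_zero_iff]
      have := le_two_mul_indexCore d
      omega
    simp [h]
  rw [hR' R hR, ← hR' (2 * N) (by omega)]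
  rw [← Finset.sum_fiberwise_of_maps_to (t := Ioc 0 (2 * N)) (g := indexCore)]
  · symm
    refine Finset.sum_subset_zero_on_sdiff (Ioc_subset_Ioc_right (by omega)) ?_ ?_
    · intro e he
      refine Finset.sum_eq_zero fun d hd => ?_
      obtain ⟨-, rfl⟩ := mem_filter.1 hd
      have h : N / (2 * indexCore d) = 0 := by
        rw [Finset.mem_sdiff, mem_Ioc, mem_Ioc] at he
        rw [Nat.div_eq_zero_iff]
        omega
      simp [h]
    · intro e he
      rw [mem_Ioc] at he
      rw [← sum_totient_indexCore_eq he.1 he.2, Finset.sum_mul]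
      refine Finset.sum_congr rfl fun d hd => ?_
      rw [(mem_filter.1 hd).2]
  · intro d hd
    rw [mem_Ioc] at hd ⊢
    exact ⟨indexCore_pos hd.1, (indexCore_le d).trans hd.2⟩

/-! ### The divisor sum in the error term -/

theorem sum_card_divisors_le (N : ℕ) :
    ∑ n ∈ Ioc 0 N, (n.divisors.card : ℝ) ≤ N * (1 + Real.log N) := by
  have h := ArithmeticFunction.sum_Ioc_sigma0_eq_sum_div N
  simp_rw [ArithmeticFunction.sigma_zero_apply] at h
  have h' : ∑ n ∈ Ioc 0 N, (n.divisors.card : ℝ) = ∑ n ∈ Ioc 0 N, ((N / n : ℕ) : ℝ) := by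
    exact_mod_cast h
  rw [h']
  calc ∑ n ∈ Ioc 0 N, ((N / n : ℕ) : ℝ) ≤ ∑ n ∈ Ioc 0 N, (N : ℝ) * (n : ℝ)⁻¹ :=
        Finset.sum_le_sum fun n _ => Nat.cast_div_le
    _ = N * ((harmonic N : ℚ) : ℝ) := by
        rw [harmonic_eq_sum_Icc, Rat.cast_sum, Finset.mul_sum]
        push_cast
        rfl
    _ ≤ _ := by
        gcongr
        exact harmonic_le_one_add_log N

theorem tendsto_sum_card_divisors_mul_log :
    Tendsto (fun N : ℕ => ((∑ n ∈ Ioc 0 N, (n.divisors.card : ℝ)) * (1 + Real.log N)) /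
      (N : ℝ) ^ 2) atTop (𝓝 0) := by
  have hlim : Tendsto (fun x : ℝ => 1 / x + 2 * (Real.log x ^ 1 / x) + Real.log x ^ 2 / x) atTop
      (𝓝 (0 + 2 * 0 + 0)) := by
    have hl : ∀ k : ℕ, Tendsto (fun x : ℝ => Real.log x ^ k / x) atTop (𝓝 0) := fun k =>
      (Real.isLittleO_pow_log_id_atTop (n := k)).tendsto_div_nhds_zero
    have h0 := hl 0
    simp only [pow_zero] at h0
    exact (h0.add ((hl 1).const_mul 2)).add (hl 2)
  simp only [mul_zero, add_zero] at hlim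
  refine squeeze_zero (fun N => ?_) (fun N => ?_) (hlim.comp tendsto_natCast_atTop_atTop)
  · have := Real.log_natCast_nonneg N
    positivity
  · have h := sum_card_divisors_le N
    have hlog := Real.log_natCast_nonneg N
    simp only [Function.comp_apply]
    rcases Nat.eq_zero_or_pos N with rfl | hN
    · simp
    have hN' : (0 : ℝ) < N := by exact_mod_cast hN
    rw [div_le_iff₀ (by positivity)]
    calc _ ≤ (N * (1 + Real.log N)) * (1 + Real.log N) := by gcongr
      _ = _ := by
        field_simp
        ring

open MeasureTheory ProbabilityTheory

/-! ### The probability that a primitive part occurs -/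

theorem IsRandomSigns.ae_eq_one_or {Ω : Type*} [MeasurableSpace Ω] {P : Measure Ω}
    [IsProbabilityMeasure P] {s : ℕ → Ω → ℤ} (hs : IsRandomSigns P s) :
    ∀ᵐ ω ∂P, ∀ k, 1 ≤ k → s k ω = 1 ∨ s k ω = -1 := by
  refine ae_all_iff.2 fun k => ae_all_iff.2 fun hk => ?_
  have hm := hs.measurable k hk
  have h1 : MeasurableSet {ω | s k ω = 1} := hm (measurableSet_singleton 1)
  have h2 : MeasurableSet {ω | s k ω = -1} := hm (measurableSet_singleton (-1))
  have hdisj : Disjoint {ω | s k ω = 1} {ω | s k ω = -1} := by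
    rw [Set.disjoint_left]
    intro ω h h'
    simp only [Set.mem_ofPred_eq] at h h'
    omega
  have hP : P ({ω | s k ω = 1} ∪ {ω | s k ω = -1}) = 1 := by
    rw [measure_union hdisj h2, hs.prob_pos k hk, hs.prob_neg k hk]
    exact ENNReal.add_halves 1
  have := (prob_compl_eq_zero_iff (h1.union h2)).2 hP
  rw [ae_iff]
  convert this using 2
  ext ω
  simp

/-- The probability that `F_k + s_k` misses the `d`-th primitive part. -/
theorem IsRandomSigns.measure_notMem_primitiveIndices {Ω : Type*} [MeasurableSpace Ω]
    {P : Measure Ω} [IsProbabilityMeasure P] {s : ℕ → Ω → ℤ} (hs : IsRandomSigns P s) {k d : ℕ}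
    (hk : 3 ≤ k) (hd : 3 ≤ indexCore d) :
    P (s k ⁻¹' {z | d ∉ primitiveIndices (shiftedFibIndices k z)}) =
      if indexCore d ∣ (k - 1) / 2 ∨ indexCore d ∣ k / 2 + 1 then 1 / 2 else 1 := by
  split_ifs with h
  · have hsign := mem_primitiveIndices_sign hk hd h
    by_cases h1 : d ∈ primitiveIndices (shiftedFibIndices k 1)
    · rw [← hs.prob_neg k (by omega)]
      refine measure_congr ?_
      filter_upwards [hs.ae_eq_one_or] with ω hω
      refine propext ?_
      change d ∉ primitiveIndices (shiftedFibIndices k (s k ω)) ↔ s k ω = -1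
      rcases hω k (by omega) with e | e <;> rw [e]
      · simp [h1]
      · simp [hsign.1 h1]
    · rw [← hs.prob_pos k (by omega)]
      refine measure_congr ?_
      filter_upwards [hs.ae_eq_one_or] with ω hω
      refine propext ?_
      change d ∉ primitiveIndices (shiftedFibIndices k (s k ω)) ↔ s k ω = 1
      rcases hω k (by omega) with e | e <;> rw [e]
      · simp [h1]
      · have := not_not.1 (mt hsign.2 h1)
        simp [this]
  · have : s k ⁻¹' {z | d ∉ primitiveIndices (shiftedFibIndices k z)} = Set.univ :=
      Set.eq_univ_of_forall fun ω => notMem_primitiveIndices_sign hk (s k ω) h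
    rw [this, measure_univ]

/-- By independence, the `d`-th primitive part is missed by all of `F₃ + s₃, …, F_n + s_n` with
probability `2^{-r}`, where `r` is the number of relevant indices. -/
theorem IsRandomSigns.measure_notMem_shiftedIndices {Ω : Type*} [MeasurableSpace Ω]
    {P : Measure Ω} [IsProbabilityMeasure P] {s : ℕ → Ω → ℤ} (hs : IsRandomSigns P s) (n : ℕ)
    {d : ℕ} (hd : 3 ≤ indexCore d) :
    P {ω | d ∉ shiftedIndices (fun k => s k ω) n} =
      (1 / 2) ^ (relevantIndices (indexCore d) n).card := by
  have hcoe : ∀ k ∈ Icc 3 n, ((k.toPNat' : ℕ+) : ℕ) = k := fun k hk => by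
    have := (Finset.mem_Icc.1 hk).1
    rw [Nat.toPNat'_coe, if_pos (by omega)]
  have hinj : Set.InjOn Nat.toPNat' (Icc 3 n : Finset ℕ) := fun a ha b hb hab => by
    rw [← hcoe a ha, ← hcoe b hb, hab]
  have h := hs.indep.measure_inter_preimage_eq_mul ((Icc 3 n).image Nat.toPNat')
    (sets := fun k => {z | d ∉ primitiveIndices (shiftedFibIndices k z)})
    (fun k _ => MeasurableSet.of_discrete)
  rw [Finset.prod_image hinj] at h
  have hset : {ω | d ∉ shiftedIndices (fun k => s k ω) n} =
      ⋂ i ∈ (Icc 3 n).image Nat.toPNat',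
        s i ⁻¹' {z | d ∉ primitiveIndices (shiftedFibIndices i z)} := by
    ext ω
    simp only [shiftedIndices, Set.mem_ofPred_eq, Finset.mem_biUnion, not_exists, not_and,
      Set.mem_iInter, Finset.mem_image, Set.mem_preimage, forall_exists_index, and_imp,
      forall_apply_eq_imp_iff₂]
    refine forall₂_congr fun k hk => ?_
    rw [hcoe k hk]
  rw [hset, h]
  calc _ = ∏ k ∈ Icc 3 n,
        if indexCore d ∣ (k - 1) / 2 ∨ indexCore d ∣ k / 2 + 1 then (1 / 2 : ENNReal) else 1 := by
        refine Finset.prod_congr rfl fun k hk => ?_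
        rw [hcoe k hk]
        exact hs.measure_notMem_primitiveIndices (Finset.mem_Icc.1 hk).1 hd
    _ = _ := by
        rw [Finset.prod_ite, Finset.prod_const, Finset.prod_const_one, mul_one]
        rfl

theorem IsRandomSigns.measurableSet_mem_shiftedIndices {Ω : Type*} [MeasurableSpace Ω]
    {P : Measure Ω} {s : ℕ → Ω → ℤ} (hs : IsRandomSigns P s) (n d : ℕ) :
    MeasurableSet {ω | d ∈ shiftedIndices (fun k => s k ω) n} := by
  have : {ω | d ∈ shiftedIndices (fun k => s k ω) n} = ⋃ k ∈ Icc 3 n,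
      s k ⁻¹' {z | d ∈ primitiveIndices (shiftedFibIndices k z)} := by
    ext ω
    simp [shiftedIndices]
  rw [this]
  refine Finset.measurableSet_biUnion _ fun k hk => ?_
  exact hs.measurable k (by have := (Finset.mem_Icc.1 hk).1; omega) MeasurableSet.of_discrete

theorem IsRandomSigns.measurable_shiftedFibLcm {Ω : Type*} [MeasurableSpace Ω]
    {P : Measure Ω} {s : ℕ → Ω → ℤ} (hs : IsRandomSigns P s) (n : ℕ) :
    Measurable fun ω => shiftedFibLcm (fun k => s k ω) n := by
  unfold shiftedFibLcm
  have : ∀ S : Finset ℕ, (∀ k ∈ S, 1 ≤ k) →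
      Measurable fun ω => S.lcm fun k => (Nat.fib k : ℤ) + s k ω := by
    intro S
    induction S using Finset.induction_on with
    | empty => simp
    | insert a S _ ih =>
      intro hS
      simp only [Finset.lcm_insert]
      have h1 := hs.measurable a (hS a (Finset.mem_insert_self _ _))
      have h2 := ih fun k hk => hS k (Finset.mem_insert_of_mem hk)
      exact (Measurable.of_discrete (f := fun p : ℤ × ℤ => lcm ((Nat.fib a : ℤ) + p.1) p.2)).comp
        (h1.prodMk h2)
  exact this _ fun k hk => by have := (Finset.mem_Icc.1 hk).1; omega

/-- The `d`-th primitive part occurs with probability about `1 - 16^{-⌊n / 2e⌋}`, where `e` is the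
core of `d`. -/
theorem IsRandomSigns.one_sub_le_measureReal {Ω : Type*} [MeasurableSpace Ω]
    {P : Measure Ω} [IsProbabilityMeasure P] {s : ℕ → Ω → ℤ} (hs : IsRandomSigns P s) (n : ℕ)
    {d : ℕ} (hd : 3 ≤ indexCore d) :
    1 - (1 / 16 : ℝ) ^ ((n - 2) / (2 * indexCore d)) ≤
      P.real {ω | d ∈ shiftedIndices (fun k => s k ω) n} ∧
    P.real {ω | d ∈ shiftedIndices (fun k => s k ω) n} ≤
      1 - (1 / 16 : ℝ) ^ ((n + 2) / (2 * indexCore d)) := by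
  have h1 : P.real {ω | d ∈ shiftedIndices (fun k => s k ω) n} =
      1 - (1 / 2 : ℝ) ^ (relevantIndices (indexCore d) n).card := by
    have h := probReal_compl_eq_one_sub (μ := P) (hs.measurableSet_mem_shiftedIndices n d)
    have h' : P.real {ω | d ∈ shiftedIndices (fun k => s k ω) n}ᶜ =
        (1 / 2 : ℝ) ^ (relevantIndices (indexCore d) n).card := by
      rw [measureReal_def, Set.compl_ofPred, hs.measure_notMem_shiftedIndices n hd]
      simp
    linarith
  have h16 : ∀ r : ℕ, (1 / 16 : ℝ) ^ r = (1 / 2 : ℝ) ^ (4 * r) := fun r => by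
    rw [pow_mul]
    norm_num
  rw [h1, h16, h16]
  constructor
  · exact sub_le_sub_left (pow_le_pow_of_le_one (by norm_num) (by norm_num)
      (le_card_relevantIndices hd n)) 1
  · exact sub_le_sub_left (pow_le_pow_of_le_one (by norm_num) (by norm_num)
      (card_relevantIndices_le hd n)) 1

/-- Only `d = 1, 2, 4` have a core below `3`. -/
theorem sum_totient_small_core_le (R : ℕ) :
    ∑ d ∈ Ioc 0 R, (if indexCore d < 3 then (d.totient : ℝ) else 0) ≤ 4 := by
  rw [← Finset.sum_filter]
  calc _ ≤ ∑ d ∈ ({1, 2, 4} : Finset ℕ), (d.totient : ℝ) := by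
        refine Finset.sum_le_sum_of_subset_of_nonneg (fun d hd => ?_) fun _ _ _ => by positivity
        obtain ⟨hd, h⟩ := Finset.mem_filter.1 hd
        rw [Finset.mem_Ioc] at hd
        have := le_two_mul_indexCore d
        have hd4 : d ≤ 4 := by omega
        have hd0 := hd.1
        clear hd
        interval_cases d
        · simp
        · simp
        · simp [indexCore, show ¬ Even 3 by decide] at h
        · simp
    _ = 4 := by
        have : Nat.totient 4 = 2 := by decide
        simp [this]
        norm_num

/-- The constant `4` absorbs the indices with core below `3`, for which the blocks of relevant
indices would overlap. -/
theorem IsRandomSigns.sum_totient_mul_measureReal_bounds {Ω : Type*} [MeasurableSpace Ω]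
    {P : Measure Ω} [IsProbabilityMeasure P] {s : ℕ → Ω → ℤ} (hs : IsRandomSigns P s) (n : ℕ) :
    ∑ e ∈ Ioc 0 (n - 2), 2 * (e.totient : ℝ) * (1 - (1 / 16 : ℝ) ^ ((n - 2) / (2 * e))) - 4 ≤
      ∑ d ∈ Ioc 0 (n + 2),
        (d.totient : ℝ) * P.real {ω | d ∈ shiftedIndices (fun k => s k ω) n} ∧
    ∑ d ∈ Ioc 0 (n + 2),
        (d.totient : ℝ) * P.real {ω | d ∈ shiftedIndices (fun k => s k ω) n} ≤
      ∑ e ∈ Ioc 0 (n + 2), 2 * (e.totient : ℝ) * (1 - (1 / 16 : ℝ) ^ ((n + 2) / (2 * e))) + 4 := by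
  have h4 := sum_totient_small_core_le (n + 2)
  have hle : ∀ r : ℕ, 0 ≤ (1 / 16 : ℝ) ^ r ∧ (1 / 16 : ℝ) ^ r ≤ 1 := fun r =>
    ⟨by positivity, pow_le_one₀ (by norm_num) (by norm_num)⟩
  rw [← sum_totient_indexCore_weighted (show n - 2 ≤ n + 2 by omega),
    ← sum_totient_indexCore_weighted le_rfl]
  constructor
  · rw [sub_le_iff_le_add]
    refine le_trans ?_ (add_le_add_right h4 _)
    rw [← Finset.sum_add_distrib]
    refine Finset.sum_le_sum fun d _ => ?_
    split_ifs with h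
    · have h1 := hle ((n - 2) / (2 * indexCore d))
      have h2 : 0 ≤ (d.totient : ℝ) * P.real {ω | d ∈ shiftedIndices (fun k => s k ω) n} := by
        positivity
      have h3 : (d.totient : ℝ) * (1 - (1 / 16 : ℝ) ^ ((n - 2) / (2 * indexCore d))) ≤ d.totient :=
        mul_le_of_le_one_right (Nat.cast_nonneg _) (by linarith)
      linarith
    · rw [add_zero]
      exact mul_le_mul_of_nonneg_left (hs.one_sub_le_measureReal n (not_lt.1 h)).1
        (Nat.cast_nonneg _)
  · refine le_trans ?_ (add_le_add_right h4 _)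
    rw [← Finset.sum_add_distrib]
    refine Finset.sum_le_sum fun d _ => ?_
    split_ifs with h
    · have h1 := hle ((n + 2) / (2 * indexCore d))
      have h2 : (d.totient : ℝ) * P.real {ω | d ∈ shiftedIndices (fun k => s k ω) n} ≤
          d.totient := mul_le_of_le_one_right (Nat.cast_nonneg _) measureReal_le_one
      have h3 : 0 ≤ (d.totient : ℝ) * (1 - (1 / 16 : ℝ) ^ ((n + 2) / (2 * indexCore d))) :=
        mul_nonneg (Nat.cast_nonneg _) (by linarith)
      linarith
    · rw [add_zero]
      exact mul_le_mul_of_nonneg_left (hs.one_sub_le_measureReal n (not_lt.1 h)).2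
        (Nat.cast_nonneg _)

/-! ### The expected logarithm -/

theorem IsRandomSigns.integrable_and_integral_sum_log {Ω : Type*} [MeasurableSpace Ω]
    {P : Measure Ω} [IsProbabilityMeasure P] {s : ℕ → Ω → ℤ} (hs : IsRandomSigns P s) (n : ℕ) :
    Integrable (fun ω => ∑ d ∈ shiftedIndices (fun k => s k ω) n,
      Real.log (fibPrimitivePart d)) P ∧
    ∫ ω, ∑ d ∈ shiftedIndices (fun k => s k ω) n, Real.log (fibPrimitivePart d) ∂P =
      ∑ d ∈ Ioc 0 (n + 2), P.real {ω | d ∈ shiftedIndices (fun k => s k ω) n} *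
        Real.log (fibPrimitivePart d) := by
  have h : (fun ω => ∑ d ∈ shiftedIndices (fun k => s k ω) n,
      Real.log (fibPrimitivePart d)) = fun ω => ∑ d ∈ Ioc 0 (n + 2),
        {ω | d ∈ shiftedIndices (fun k => s k ω) n}.indicator
          (fun _ => Real.log (fibPrimitivePart d)) ω := by
    ext ω
    simp only [Set.indicator_apply, Set.mem_ofPred_eq]
    rw [← Finset.sum_filter]
    refine Finset.sum_congr ?_ fun _ _ => rfl
    ext d
    rw [Finset.mem_filter]
    refine ⟨fun hd => ⟨shiftedIndices_subset _ _ hd, hd⟩, fun hd => hd.2⟩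
  have hint : ∀ d ∈ Ioc 0 (n + 2), Integrable ({ω | d ∈ shiftedIndices (fun k => s k ω) n}.indicator
      (fun _ => Real.log (fibPrimitivePart d))) P := fun d _ =>
    (integrable_const _).indicator (hs.measurableSet_mem_shiftedIndices n d)
  rw [h]
  refine ⟨integrable_finsetSum _ hint, ?_⟩
  rw [integral_finsetSum _ hint]
  refine Finset.sum_congr rfl fun d _ => ?_
  rw [integral_indicator_const _ (hs.measurableSet_mem_shiftedIndices n d), smul_eq_mul]

theorem sum_card_divisors_mul_log_le (N : ℕ) :
    ∑ e ∈ Ioc 0 N, (e.divisors.card : ℝ) * Real.log e ≤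
      (∑ e ∈ Ioc 0 N, (e.divisors.card : ℝ)) * (1 + Real.log N) := by
  rw [Finset.sum_mul]
  refine Finset.sum_le_sum fun e he => ?_
  rw [Finset.mem_Ioc] at he
  have : Real.log e ≤ Real.log N :=
    Real.log_le_log (by exact_mod_cast he.1) (by exact_mod_cast he.2)
  gcongr
  linarith

theorem abs_sum_log_fibPrimitivePart_sub_le (N : ℕ) {p : ℕ → ℝ} (hp0 : ∀ d, 0 ≤ p d)
    (hp1 : ∀ d, p d ≤ 1) :
    |∑ d ∈ Ioc 0 N, p d * Real.log (fibPrimitivePart d) -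
      Real.log Real.goldenRatio * ∑ d ∈ Ioc 0 N, (d.totient : ℝ) * p d| ≤
      2 * Real.log Real.goldenRatio *
        ((∑ e ∈ Ioc 0 N, (e.divisors.card : ℝ)) * (1 + Real.log N)) := by
  have hα : 0 ≤ Real.log Real.goldenRatio := Real.log_nonneg Real.one_lt_goldenRatio.le
  have hN := Real.log_natCast_nonneg N
  calc _ ≤ ∑ d ∈ Ioc 0 N, 2 * Real.log Real.goldenRatio * (d.divisors.card : ℝ) := by
        rw [Finset.mul_sum, ← Finset.sum_sub_distrib]
        refine (Finset.abs_sum_le_sum_abs _ _).trans (Finset.sum_le_sum fun d hd => ?_)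
        have h := abs_log_fibPrimitivePart_sub_le (Finset.mem_Ioc.1 hd).1
        rw [show p d * Real.log (fibPrimitivePart d) -
          Real.log Real.goldenRatio * ((d.totient : ℝ) * p d) =
          p d * (Real.log (fibPrimitivePart d) - d.totient * Real.log Real.goldenRatio) by ring,
          abs_mul, abs_of_nonneg (hp0 d)]
        exact (mul_le_of_le_one_left (abs_nonneg _) (hp1 d)).trans h
    _ = 2 * Real.log Real.goldenRatio * ((∑ e ∈ Ioc 0 N, (e.divisors.card : ℝ)) * 1) := by
        rw [← Finset.mul_sum, mul_one]
    _ ≤ _ := by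
        gcongr
        linarith

theorem IsRandomSigns.integrable_log_shiftedFibLcm {Ω : Type*} [MeasurableSpace Ω]
    {P : Measure Ω} [IsProbabilityMeasure P] {s : ℕ → Ω → ℤ} (hs : IsRandomSigns P s) (n : ℕ) :
    Integrable (fun ω => Real.log (shiftedFibLcm (fun k => s k ω) n : ℝ)) P := by
  refine Integrable.mono'
    ((hs.integrable_and_integral_sum_log n).1.add (integrable_const (Real.log 3))) ?_ ?_
  · exact (Real.measurable_log.comp ((Measurable.of_discrete (f := fun z : ℤ => (z : ℝ))).comp
      (hs.measurable_shiftedFibLcm n))).aestronglyMeasurable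
  · filter_upwards [hs.ae_eq_one_or] with ω hω
    have hω' : ∀ k, 3 ≤ k → s k ω = 1 ∨ s k ω = -1 := fun k hk => hω k (by omega)
    have h1 : (1 : ℝ) ≤ shiftedFibLcm (fun k => s k ω) n := by
      exact_mod_cast shiftedFibLcm_pos hω' n
    rw [Real.norm_eq_abs, abs_of_nonneg (Real.log_nonneg h1)]
    exact log_shiftedFibLcm_le hω' n

/-- The expected logarithm is `log α` times the expected sum of `φ(d)` over the indices that
occur, up to an error `o(n²)`. -/
theorem IsRandomSigns.abs_integral_log_shiftedFibLcm_sub_le {Ω : Type*} [MeasurableSpace Ω]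
    {P : Measure Ω} [IsProbabilityMeasure P] {s : ℕ → Ω → ℤ} (hs : IsRandomSigns P s) (n : ℕ) :
    |∫ ω, Real.log (shiftedFibLcm (fun k => s k ω) n : ℝ) ∂P -
      Real.log Real.goldenRatio * ∑ d ∈ Ioc 0 (n + 2),
        (d.totient : ℝ) * P.real {ω | d ∈ shiftedIndices (fun k => s k ω) n}| ≤
      (1 + 2 * Real.log Real.goldenRatio) * ((∑ e ∈ Ioc 0 (n + 2), (e.divisors.card : ℝ)) *
        (1 + Real.log (n + 2 : ℕ))) + Real.log 3 := by
  obtain ⟨hint, hval⟩ := hs.integrable_and_integral_sum_log n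
  have hu : ∫ ω, Real.log (shiftedFibLcm (fun k => s k ω) n : ℝ) ∂P ≤
      ∫ ω, ((∑ d ∈ shiftedIndices (fun k => s k ω) n, Real.log (fibPrimitivePart d)) +
        Real.log 3) ∂P := by
    refine integral_mono_ae (hs.integrable_log_shiftedFibLcm n)
      (hint.add (integrable_const _)) ?_
    filter_upwards [hs.ae_eq_one_or] with ω hω
    exact log_shiftedFibLcm_le (fun k hk => hω k (by omega)) n
  have hl : ∫ ω, ((∑ d ∈ shiftedIndices (fun k => s k ω) n, Real.log (fibPrimitivePart d)) -
        ∑ e ∈ Icc 1 (n + 2), (e.divisors.card : ℝ) * Real.log e) ∂P ≤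
      ∫ ω, Real.log (shiftedFibLcm (fun k => s k ω) n : ℝ) ∂P := by
    refine integral_mono_ae (hint.sub (integrable_const _))
      (hs.integrable_log_shiftedFibLcm n) ?_
    filter_upwards [hs.ae_eq_one_or] with ω hω
    exact le_log_shiftedFibLcm (fun k hk => hω k (by omega)) n
  rw [integral_add hint (integrable_const _), hval, integral_const, probReal_univ, one_smul] at hu
  rw [integral_sub hint (integrable_const _), hval, integral_const, probReal_univ, one_smul] at hl
  have h1 := abs_sum_log_fibPrimitivePart_sub_le (n + 2)
    (p := fun d => P.real {ω | d ∈ shiftedIndices (fun k => s k ω) n})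
    (fun _ => measureReal_nonneg) (fun _ => measureReal_le_one)
  have h2 : ∑ e ∈ Icc 1 (n + 2), (e.divisors.card : ℝ) * Real.log e ≤ _ :=
    sum_card_divisors_mul_log_le (n + 2)
  have h3 : 0 ≤ (∑ e ∈ Ioc 0 (n + 2), (e.divisors.card : ℝ)) * (1 + Real.log (n + 2 : ℕ)) := by
    have := Real.log_natCast_nonneg (n + 2)
    positivity
  have h4 : 0 ≤ Real.log 3 := Real.log_nonneg (by norm_num)
  rw [abs_le] at h1 ⊢
  constructor <;> linarith [h1.1, h1.2]

theorem IsRandomSigns.tendsto_integral_log_shiftedFibLcm_div_sq {Ω : Type*} [MeasurableSpace Ω]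
    {P : Measure Ω} [IsProbabilityMeasure P] {s : ℕ → Ω → ℤ} (hs : IsRandomSigns P s) :
    Tendsto (fun n : ℕ => (∫ ω, Real.log (shiftedFibLcm (fun k => s k ω) n : ℝ) ∂P) / (n : ℝ) ^ 2)
      atTop
      (𝓝 (Real.log Real.goldenRatio * (3 / Real.pi ^ 2 * (15 * dilog (1 / 16) / 2)))) := by
  have hα : 0 ≤ Real.log Real.goldenRatio := Real.log_nonneg Real.one_lt_goldenRatio.le
  have hplus : Tendsto (fun n : ℕ => n + 2) atTop atTop := tendsto_add_atTop_nat 2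
  have hminus : Tendsto (fun n : ℕ => n - 2) atTop atTop := tendsto_sub_atTop_nat 2
  have hinv : Tendsto (fun n : ℕ => 2 * (1 / (n : ℝ))) atTop (𝓝 (2 * 0)) :=
    tendsto_one_div_atTop_nhds_zero_nat.const_mul 2
  have hplus1 : Tendsto (fun n : ℕ => ((n + 2 : ℕ) : ℝ) / n) atTop (𝓝 1) := by
    have := hinv.const_add 1
    rw [mul_zero, add_zero] at this
    refine this.congr' ?_
    filter_upwards [eventually_gt_atTop 0] with n hn
    have : (n : ℝ) ≠ 0 := by exact_mod_cast hn.ne'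
    push_cast
    field_simp
  have hminus1 : Tendsto (fun n : ℕ => ((n - 2 : ℕ) : ℝ) / n) atTop (𝓝 1) := by
    have := hinv.const_sub 1
    rw [mul_zero, sub_zero] at this
    refine this.congr' ?_
    filter_upwards [eventually_ge_atTop 2] with n hn
    have : (n : ℝ) ≠ 0 := by exact_mod_cast (by omega : n ≠ 0)
    rw [Nat.cast_sub hn]
    push_cast
    field_simp
  have hVp := tendsto_comp_div_sq tendsto_sum_totient_weighted hplus hplus1
  have hVm := tendsto_comp_div_sq tendsto_sum_totient_weighted hminus hminus1
  have hE := tendsto_comp_div_sq tendsto_sum_card_divisors_mul_log hplus hplus1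
  simp only [one_pow, mul_one] at hVp hVm hE
  have hc : ∀ c : ℝ, Tendsto (fun n : ℕ => c / (n : ℝ) ^ 2) atTop (𝓝 0) := fun c =>
    tendsto_const_nhds.div_atTop
      ((tendsto_pow_atTop (by norm_num)).comp tendsto_natCast_atTop_atTop)
  have hup := ((hVp.add (hc 4)).const_mul (Real.log Real.goldenRatio)).add
    ((hE.const_mul (1 + 2 * Real.log Real.goldenRatio)).add (hc (Real.log 3)))
  have hlow := ((hVm.sub (hc 4)).const_mul (Real.log Real.goldenRatio)).sub
    ((hE.const_mul (1 + 2 * Real.log Real.goldenRatio)).add (hc (Real.log 3)))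
  simp only [mul_zero, add_zero, sub_zero] at hup hlow
  refine tendsto_of_tendsto_of_tendsto_of_le_of_le hlow hup (fun n => ?_) (fun n => ?_)
  · have h1 := (abs_le.1 (hs.abs_integral_log_shiftedFibLcm_sub_le n)).1
    have h2 := mul_le_mul_of_nonneg_left (hs.sum_totient_mul_measureReal_bounds n).1 hα
    dsimp only
    rw [← sub_div, ← mul_div_assoc, ← mul_div_assoc, ← add_div, ← sub_div]
    gcongr
    linarith
  · have h1 := (abs_le.1 (hs.abs_integral_log_shiftedFibLcm_sub_le n)).2
    have h2 := mul_le_mul_of_nonneg_left (hs.sum_totient_mul_measureReal_bounds n).2 hα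
    dsimp only
    rw [← add_div, ← mul_div_assoc, ← mul_div_assoc, ← add_div, ← add_div]
    gcongr
    linarith

theorem dilog_pos {z : ℝ} (hz : 0 < z) (hz1 : z < 1) : 0 < dilog z := by
  have hsum : Summable fun n : ℕ => z ^ (n + 1) / ((n : ℝ) + 1) ^ 2 := by
    refine Summable.of_nonneg_of_le (fun n => by positivity) (fun n => ?_)
      ((summable_nat_add_iff 1).2 (summable_geometric_of_lt_one hz.le hz1))
    refine div_le_self (by positivity) ?_
    have : (0 : ℝ) ≤ n := Nat.cast_nonneg n
    nlinarith
  exact hsum.tsum_pos (fun n => by positivity) 0 (by positivity)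

theorem theorem2 {Ω : Type*} [MeasurableSpace Ω] (P : MeasureTheory.Measure Ω)
    [MeasureTheory.IsProbabilityMeasure P] (s : ℕ → Ω → ℤ) (hs : IsRandomSigns P s) :
    (∀ n : ℕ, MeasureTheory.Integrable
      (fun ω => Real.log (shiftedFibLcm (fun k => s k ω) n : ℝ)) P) ∧
    Asymptotics.IsEquivalent Filter.atTop
      (fun n : ℕ => ∫ ω, Real.log (shiftedFibLcm (fun k => s k ω) n : ℝ) ∂P)
      (fun n : ℕ => 3 * Real.log Real.goldenRatio / Real.pi ^ 2 * (15 * dilog (1 / 16) / 2)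
        * (n : ℝ) ^ 2) := by
  refine ⟨hs.integrable_log_shiftedFibLcm, ?_⟩
  have hpos : 0 < 3 * Real.log Real.goldenRatio / Real.pi ^ 2 * (15 * dilog (1 / 16) / 2) := by
    have h1 := Real.log_pos Real.one_lt_goldenRatio
    have h2 : 0 < dilog (1 / 16) := dilog_pos (by norm_num) (by norm_num)
    have h3 := Real.pi_pos
    positivity
  set c := 3 * Real.log Real.goldenRatio / Real.pi ^ 2 * (15 * dilog (1 / 16) / 2) with hc
  refine (Asymptotics.isEquivalent_iff_tendsto_one ?_).2 ?_
  · filter_upwards [eventually_gt_atTop 0] with n hn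
    have : (n : ℝ) ≠ 0 := by exact_mod_cast hn.ne'
    exact mul_ne_zero hpos.ne' (pow_ne_zero 2 this)
  · have h := hs.tendsto_integral_log_shiftedFibLcm_div_sq.div_const c
    have h1 :
        Real.log Real.goldenRatio * (3 / Real.pi ^ 2 * (15 * dilog (1 / 16) / 2)) / c = 1 := by
      rw [div_eq_one_iff_eq hpos.ne', hc]
      ring
    rw [h1] at h
    refine h.congr fun n => ?_
    simp only [Pi.div_apply]
    rw [div_div, mul_comm]
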